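/- Let $P_\infty$ be the infinite path graph (vertex set $\mathbb{Z}$, consecutive integers joined by an edge), so that for $k\ge 1$ its $k$-path Laplacian $(L_k v)_n=\sum_{m:\,d(n,m)=k}(v_n-v_m)=2v_n-v_{n+k}-v_{n-k}$ is a bounded operator on $\ell^2(\mathbb{Z})$. Let $s>1$ and let $L=\sum_{k=1}^{\infty}k^{-s}L_k$ be the Mellin-transformed $k$-path Laplacian (the series converges in operator norm). Let $u:[0,\infty)\to\ell^2(\mathbb{Z})$ be the solution of $\frac{d}{dt}u(t)=-Lu(t)$, $u(0)=e_0$, where $(e_0)_n=\delta_{n,0}$. For $0<\alpha\le 2$ and $\gamma>0$ denote by $$f(\xi;\alpha,0,\gamma,0)=\frac1{2\pi}\int_{-\infty}^{\infty}e^{-|\gamma z|^{\alpha}}e^{i\xi z}\,dz,\qquad \xi\in\mathbb{R},$$ the density of the symmetric stable distribution $S(\alpha,0,\gamma,0)$. If $s\neq 3$, then $$(u(t))_x=t^{-1/\alpha}f\bigl(t^{-1/\alpha}x;\alpha,0,\gamma,0\bigr)+o\bigl(t^{-1/\alpha}\bigr)\qquad\text{as } t\to\infty,$$ uniformly in $x\in\mathbb{Z}$,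 where $$\alpha=s-1,\quad \gamma=\Bigl(-\frac{\pi}{\Gamma(s)\cos(\pi s/2)}\Bigr)^{1/(s-1)}\quad\text{if } 1<s<3,$$ $$\alpha=2,\quad \gamma=\sqrt{\zeta(s-2)}\quad\text{if } s>3.$$ Moreover, if $1<s<3$ and $\alpha,\gamma$ are as above, then $$f(\xi;\alpha,0,\gamma,0)\sim\frac{1}{|\xi|^{s}}\qquad\text{as }\xi\to\pm\infty,$$ i.e. the quotient of the two sides tends to $1$ as $\xi\to+\infty$ and as $\xi\to-\infty$. -/

import Mathlib

open Filter Topology MeasureTheory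
open scoped ENNReal

noncomputable section

namespace PathLaplacian

/-- The `k`-path Laplacian mapping on functions on the vertices of a (locally finite, connected)
graph: `(𝓛_k f)(v) = ∑_{w : d(v,w) = k} (f(v) - f(w))`. -/
def kPathMap {V : Type*} (G : SimpleGraph V) (k : ℕ) (f : V → ℂ) (v : V) : ℂ :=
  ∑ᶠ (w : V) (_ : G.dist v w = k), (f v - f w)

/-- The infinite path graph: vertex set `ℤ`, consecutive integers are joined by an edge. -/
def infinitePath : SimpleGraph ℤ where
  Adj m n := n = m + 1 ∨ m = n + 1
  symm := ⟨fun _ _ h => h.symm⟩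
  loopless := ⟨fun _ h => by omega⟩

/-- The Hilbert space `ℓ²` over the vertices of the infinite path graph. -/
abbrev EllTwo : Type := lp (fun _ : ℤ => ℂ) 2

theorem infinitePath_walk_add (m : ℤ) (j : ℕ) :
    ∃ p : infinitePath.Walk m (m + j), p.length = j := by
  induction j with
  | zero => exact ⟨SimpleGraph.Walk.nil.copy rfl (by simp), by simp⟩
  | succ j ih =>
    obtain ⟨p, hp⟩ := ih
    have h : infinitePath.Adj (m + j) (m + (j + 1 : ℕ)) := Or.inl (by push_cast; ring)
    exact ⟨p.append h.toWalk, by simp [hp]⟩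

theorem infinitePath_natAbs_le_length {m n : ℤ} (p : infinitePath.Walk m n) :
    (n - m).natAbs ≤ p.length := by
  induction p with
  | nil => simp
  | cons h p ih =>
    rw [SimpleGraph.Walk.length_cons]
    have h' := h
    change _ = _ + 1 ∨ _ = _ + 1 at h'
    omega

theorem infinitePath_exists_walk (m n : ℤ) :
    ∃ p : infinitePath.Walk m n, p.length = (n - m).natAbs := by
  rcases le_total m n with h | h
  · obtain ⟨p, hp⟩ := infinitePath_walk_add m (n - m).natAbs
    exact ⟨p.copy rfl (by omega), by simp [hp]⟩
  · obtain ⟨p, hp⟩ := infinitePath_walk_add n (n - m).natAbs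
    exact ⟨(p.copy rfl (by omega)).reverse, by simp [hp]⟩

theorem infinitePath_connected : infinitePath.Connected :=
  { preconnected := fun m n => ⟨(infinitePath_exists_walk m n).choose⟩
    nonempty := ⟨0⟩ }

theorem infinitePath_dist (m n : ℤ) : infinitePath.dist m n = (n - m).natAbs := by
  apply le_antisymm
  · obtain ⟨p, hp⟩ := infinitePath_exists_walk m n
    exact hp ▸ SimpleGraph.dist_le p
  · obtain ⟨p, hp⟩ := infinitePath_connected.exists_walk_length_eq_dist m n
    exact hp ▸ infinitePath_natAbs_le_length p

/-- On the infinite path graph, `(𝓛_k u)_n = 2 u_n - u_{n+k} - u_{n-k}`. -/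
theorem kPathMap_infinitePath (k : ℕ) (f : ℤ → ℂ) (n : ℤ) :
    kPathMap infinitePath k f n = 2 * f n - f (n + k) - f (n - k) := by
  have hset : ∀ w : ℤ, infinitePath.dist n w = k ↔ w ∈ ({n + k, n - k} : Finset ℤ) := by
    intro w
    rw [infinitePath_dist]
    simp only [Finset.mem_insert, Finset.mem_singleton]
    omega
  unfold kPathMap
  simp only [hset]
  rw [finsum_mem_finset_eq_sum]
  rcases Nat.eq_zero_or_pos k with rfl | hk
  · simp; ring
  · rw [Finset.sum_pair (by omega)]
    ring

theorem memℓp_shift (u : EllTwo) (a : ℤ) : Memℓp (fun n : ℤ => u (n + a)) 2 := by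
  have h := (lp.memℓp u).summable (by norm_num)
  refine memℓp_gen ?_
  exact h.comp_injective (add_left_injective a)

theorem norm_shift (u : EllTwo) (a : ℤ) :
    ‖(⟨fun n : ℤ => u (n + a), memℓp_shift u a⟩ : EllTwo)‖ = ‖u‖ := by
  rw [lp.norm_eq_tsum_rpow (by norm_num), lp.norm_eq_tsum_rpow (by norm_num)]
  congr 1
  exact (Equiv.addRight a).tsum_eq (fun n => ‖u n‖ ^ (2 : ℝ≥0∞).toReal)

theorem kPathMap_eq_shift (k : ℕ) (u : EllTwo) :
    kPathMap infinitePath k u =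
      ((((2 : ℂ) • u - ⟨fun n : ℤ => u (n + k), memℓp_shift u k⟩
        - ⟨fun n : ℤ => u (n + (-k : ℤ)), memℓp_shift u (-k)⟩ : EllTwo)) : ℤ → ℂ) := by
  funext n
  rw [kPathMap_infinitePath]
  change _ = 2 * u n - u (n + k) - u (n + (-k : ℤ))
  rw [← sub_eq_add_neg]

theorem memℓp_kPathMap (k : ℕ) (u : EllTwo) : Memℓp (kPathMap infinitePath k u) 2 := by
  rw [kPathMap_eq_shift]
  exact lp.memℓp _

/-- The `k`-path Laplacian `L_k` as a bounded operator on `ℓ²` over the infinite path graph. -/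
def kPathLaplacian (k : ℕ) : EllTwo →L[ℂ] EllTwo :=
  LinearMap.mkContinuous
    { toFun := fun u => ⟨kPathMap infinitePath k u, memℓp_kPathMap k u⟩
      map_add' := fun u v => by
        ext n
        simp only [lp.coeFn_add, Pi.add_apply, kPathMap_infinitePath]
        ring
      map_smul' := fun c u => by
        ext n
        simp only [lp.coeFn_smul, Pi.smul_apply, kPathMap_infinitePath, smul_eq_mul,
          RingHom.id_apply]
        ring }
    4
    (fun u => by
      have h : (⟨kPathMap infinitePath k u, memℓp_kPathMap k u⟩ : EllTwo) =
          (2 : ℂ) • u - ⟨fun n : ℤ => u (n + k), memℓp_shift u k⟩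
            - ⟨fun n : ℤ => u (n + (-k : ℤ)), memℓp_shift u (-k)⟩ :=
        Subtype.ext (kPathMap_eq_shift k u)
      change ‖(⟨kPathMap infinitePath k u, memℓp_kPathMap k u⟩ : EllTwo)‖ ≤ _
      rw [h]
      refine (norm_sub_le _ _).trans ((add_le_add_left (norm_sub_le _ _) _).trans ?_)
      rw [norm_shift, norm_shift, norm_smul]
      norm_num
      linarith)

theorem kPathLaplacian_apply (k : ℕ) (u : EllTwo) (n : ℤ) :
    kPathLaplacian k u n = kPathMap infinitePath k u n := rfl

theorem norm_kPathLaplacian_le (k : ℕ) : ‖kPathLaplacian k‖ ≤ 4 :=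
  LinearMap.mkContinuous_norm_le _ (by norm_num) _

/-- The Mellin-transformed `k`-path Laplacian `∑_{k ≥ 1} k^{-s} L_k`; the series converges in
operator norm for `s > 1` (see `summable_mellinLaplacian`). -/
def mellinLaplacian (s : ℝ) : EllTwo →L[ℂ] EllTwo :=
  ∑' k : ℕ, ((1 / ((k : ℝ) + 1) ^ s : ℝ) : ℂ) • kPathLaplacian (k + 1)

theorem summable_mellinLaplacian {s : ℝ} (hs : 1 < s) :
    Summable fun k : ℕ => ((1 / ((k : ℝ) + 1) ^ s : ℝ) : ℂ) • kPathLaplacian (k + 1) := by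
  have h : Summable fun k : ℕ => (1 / ((k : ℝ) + 1) ^ s) * 4 := by
    have h1 := (summable_nat_add_iff 1).2 (Real.summable_one_div_nat_rpow.2 hs)
    simpa using h1.mul_right 4
  refine Summable.of_norm_bounded h (fun k => ?_)
  rw [norm_smul, Complex.norm_real, Real.norm_of_nonneg (by positivity)]
  exact mul_le_mul_of_nonneg_left (norm_kPathLaplacian_le _) (by positivity)

/-- The unit vector `e_0`, the profile concentrated at the origin. -/
def e0 : EllTwo := lp.single 2 (0 : ℤ) (1 : ℂ)

/-- `u` solves `u'(t) = -L u(t)` for `t ≥ 0` with `u(0) = w`, the derivative being taken in `ℓ²`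
(one-sided at `t = 0`). -/
def IsSolution (L : EllTwo →L[ℂ] EllTwo) (w : EllTwo) (u : ℝ → EllTwo) : Prop :=
  u 0 = w ∧ ∀ t : ℝ, 0 ≤ t → HasDerivWithinAt u (-(L (u t))) (Set.Ici 0) t

/-- The evolution equation has a solution, namely `e^{-tL} w`. -/
theorem isSolution_exp (L : EllTwo →L[ℂ] EllTwo) (w : EllTwo) :
    IsSolution L w (fun t => NormedSpace.exp (t • (-L)) w) := by
  refine ⟨by simp, fun t _ => ?_⟩
  have h := (hasDerivAt_exp_smul_const' (𝕂 := ℝ) (-L) t).hasDerivWithinAt (s := Set.Ici 0)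
  have h2 := ((ContinuousLinearMap.apply ℂ EllTwo w).restrictScalars ℝ).hasFDerivAt
    |>.comp_hasDerivWithinAt t h
  exact h2

/-- The auxiliary function `ω(z, α)` in the characteristic function of a stable law. -/
def stableOmega (z α : ℝ) : ℝ :=
  if α = 1 then 2 / Real.pi * Real.log |z| else -Real.tan (Real.pi * α / 2)

/-- The characteristic function
`φ(z; α, β, γ, δ) = exp(-|γ z|^α (1 + i β sign(z) ω(z, α)) + i δ z)`. -/
def stableCharFun (z α β γ δ : ℝ) : ℂ :=
  Complex.exp (-((|γ * z| ^ α : ℝ) : ℂ) *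
      (1 + Complex.I * (β : ℂ) * ((SignType.sign z : ℝ) : ℂ) * (stableOmega z α : ℂ))
    + Complex.I * (δ : ℂ) * (z : ℂ))

/-- The density `f(ξ; α, β, γ, δ) = (1 / 2π) ∫ φ(z; α, β, γ, δ) e^{iξz} dz` of the stable
distribution. The integral is real (see `stableDensity_eq_integral`); taking the real part only
makes the type real. -/
def stableDensity (ξ α β γ δ : ℝ) : ℝ :=
  ((1 / (2 * Real.pi) : ℂ) *
    ∫ z : ℝ, stableCharFun z α β γ δ * Complex.exp (Complex.I * (ξ : ℂ) * (z : ℂ))).re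

theorem conj_stableCharFun (z α β γ δ : ℝ) :
    (starRingEnd ℂ) (stableCharFun z α β γ δ) = stableCharFun (-z) α β γ δ := by
  unfold stableCharFun stableOmega
  rw [← Complex.exp_conj]
  congr 1
  simp [Left.sign_neg]

theorem stableDensity_eq_integral (ξ α β γ δ : ℝ) :
    (stableDensity ξ α β γ δ : ℂ) = (1 / (2 * Real.pi) : ℂ) *
      ∫ z : ℝ, stableCharFun z α β γ δ * Complex.exp (Complex.I * (ξ : ℂ) * (z : ℂ)) := by
  unfold stableDensity
  rw [← Complex.conj_eq_iff_re, map_mul, ← integral_conj]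
  congr 1
  · simp [Complex.conj_ofNat]
  · rw [← integral_neg_eq_self]
    congr 1
    funext z
    rw [map_mul, conj_stableCharFun, ← Complex.exp_conj]
    simp

/-- `u(t)_x = t^{-1/α} f(t^{-1/α} x; α, 0, γ, 0) + o(t^{-1/α})` as `t → ∞`, uniformly in `x ∈ ℤ`. -/
def HasStableAsymptotics (u : ℝ → EllTwo) (α γ : ℝ) : Prop :=
  ∀ ε : ℝ, 0 < ε → ∃ T : ℝ, 0 < T ∧ ∀ t : ℝ, T ≤ t → ∀ x : ℤ,
    ‖u t x - ((t ^ (-(1 / α)) * stableDensity (t ^ (-(1 / α)) * (x : ℝ)) α 0 γ 0 : ℝ) : ℂ)‖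
      ≤ ε * t ^ (-(1 / α))

end PathLaplacian

end

/-!
Fourier series turn `L` into multiplication by the even symbol `ψ(θ) = ∑ k^{-s} (2 - 2 cos(kθ))`,
so that `u(t)_x = (1 / 2π) ∫_{-π}^{π} e^{-tψ(θ)} e^{-ixθ} dθ`. If `ψ(θ) ∼ |γθ|^α` at the origin, the
substitution `θ = t^{-1/α} z` makes the integrand converge to `e^{-|γz|^α}` up to the phase. As
`ψ(θ) ≥ c |θ|^α` on `[-π, π]`, the convergence is dominated, and since the phase has modulus one it
is uniform in `x`.

For `s > 3` the symbol is `ζ(s - 2) θ² + o(θ²)`. For `s < 3` the quotient `ψ(θ) / θ^{s-1}` is a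
Riemann sum with mesh `θ` of `∫_0^∞ 2 (1 - cos y) y^{-s} dy = -π / (Γ(s) cos(πs/2))`.

For the tail of the stable density one needs the behaviour of `∫_0^∞ e^{-bz^α + iz} dz` as `b → 0`,
where the integrand only oscillates in the limit. Rotating the half-line to the ray of argument
`π/4` makes `e^{iz}` decay, while `Re z^α ≥ 0` persists because `α < 2`; the rotated integral can be
differentiated at `b = 0` under the integral sign, and rotating on to `π/2` identifies the
derivative with a Gamma integral.
-/

noncomputable section

namespace PathLaplacian

/-! ### Fourier multipliers -/

instance fact_two_pi_pos : Fact (0 < 2 * Real.pi) := ⟨Real.two_pi_pos⟩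

/-- The map sending a continuous function on the circle to its sequence of Fourier coefficients. -/
def fourierSeq : C(AddCircle (2 * Real.pi), ℂ) →L[ℂ] EllTwo :=
  ((fourierBasis (T := 2 * Real.pi)).repr.toContinuousLinearEquiv :
    Lp ℂ 2 (AddCircle.haarAddCircle (T := 2 * Real.pi)) →L[ℂ] EllTwo).comp
    (ContinuousMap.toLp 2 AddCircle.haarAddCircle ℂ)

theorem fourierSeq_apply (g : C(AddCircle (2 * Real.pi), ℂ)) (n : ℤ) :
    fourierSeq g n = fourierCoeff g n := by
  rw [← fourierCoeff_toLp, ← fourierBasis_repr]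
  rfl

theorem fourierSeq_one : fourierSeq 1 = e0 := by
  ext n
  have h : (1 : C(AddCircle (2 * Real.pi), ℂ)) = fourier 0 := by
    ext x; simp
  rw [fourierSeq_apply, h, fourierCoeff_fourier, e0, lp.coeFn_single]

theorem fourierCoeff_fourier_mul {T : ℝ} [Fact (0 < T)] (g : C(AddCircle T, ℂ)) (k n : ℤ) :
    fourierCoeff (fourier k * g : C(AddCircle T, ℂ)) n = fourierCoeff g (n - k) := by
  unfold fourierCoeff
  congr 1
  funext x
  have h : -(n - k) = -n + k := by ring
  rw [h, fourier_add]
  simp [mul_assoc]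

/-- `L` is the Fourier multiplier with symbol `σ`: in terms of Fourier coefficients it is
multiplication by `σ`. The identity is only asked for on the sequences of Fourier coefficients of
continuous functions, where all the solutions considered here live. -/
def IsFourierMultiplier (L : EllTwo →L[ℂ] EllTwo) (σ : C(AddCircle (2 * Real.pi), ℂ)) : Prop :=
  ∀ g, L (fourierSeq g) = fourierSeq (σ * g)

theorem IsFourierMultiplier.const_smul {L : EllTwo →L[ℂ] EllTwo}
    {σ : C(AddCircle (2 * Real.pi), ℂ)} (h : IsFourierMultiplier L σ) (c : ℂ) :
    IsFourierMultiplier (c • L) (c • σ) := fun g => by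
  rw [smul_apply, h g, smul_mul_assoc, map_smul]

theorem IsFourierMultiplier.hasSum {ι : Type*} {L : ι → EllTwo →L[ℂ] EllTwo}
    {σ : ι → C(AddCircle (2 * Real.pi), ℂ)} (h : ∀ i, IsFourierMultiplier (L i) (σ i))
    {L' : EllTwo →L[ℂ] EllTwo} {σ' : C(AddCircle (2 * Real.pi), ℂ)}
    (hL : HasSum L L') (hσ : HasSum σ σ') : IsFourierMultiplier L' σ' := fun g =>
  (hL.mapL (ContinuousLinearMap.apply ℂ EllTwo (fourierSeq g))).unique
    (((hσ.mul_right g).mapL fourierSeq).congr_fun fun i => h i g)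

theorem IsSolution.unique {L : EllTwo →L[ℂ] EllTwo} {w : EllTwo} {u v : ℝ → EllTwo}
    (hu : IsSolution L w u) (hv : IsSolution L w v) {t : ℝ} (ht : 0 ≤ t) : u t = v t := by
  have key : ∀ {u : ℝ → EllTwo}, IsSolution L w u → ContinuousOn u (Set.Icc 0 t) ∧
      ∀ x ∈ Set.Ico 0 t, HasDerivWithinAt u (-(L (u x))) (Set.Ici x) x := fun hu =>
    ⟨fun x hx => ((hu.2 x hx.1).continuousWithinAt).mono Set.Icc_subset_Ici_self,
      fun x hx => (hu.2 x hx.1).mono (Set.Ici_subset_Ici.2 hx.1)⟩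
  exact ODE_solution_unique (v := fun _ y => -(L y)) (fun _ => (-L).lipschitz)
    (key hu).1 (key hu).2 (key hv).1 (key hv).2 (hu.1.trans hv.1.symm) ⟨ht, le_rfl⟩

theorem IsFourierMultiplier.isSolution_exp {L : EllTwo →L[ℂ] EllTwo}
    {σ : C(AddCircle (2 * Real.pi), ℂ)} (h : IsFourierMultiplier L σ) :
    IsSolution L e0 (fun t => fourierSeq (NormedSpace.exp (t • (-σ)))) := by
  refine ⟨by simp [fourierSeq_one], fun t _ => ?_⟩
  have hexp := (hasDerivAt_exp_smul_const' (𝕂 := ℝ) (-σ) t).hasDerivWithinAt (s := Set.Ici 0)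
  have hcomp := (fourierSeq.restrictScalars ℝ).hasFDerivAt.comp_hasDerivWithinAt t hexp
  convert! hcomp using 1
  rw [h, ContinuousLinearMap.coe_restrictScalars', neg_mul, map_neg]

theorem continuousMap_exp_apply {X : Type*} [TopologicalSpace X] [CompactSpace X] (g : C(X, ℂ))
    (x : X) : NormedSpace.exp g x = Complex.exp (g x) := by
  rw [Complex.exp_eq_exp_ℂ]
  exact NormedSpace.map_exp (ContinuousMap.evalAlgHom ℂ ℂ x) (continuous_eval_const x) g

theorem fourier_coe_two_pi (n : ℤ) (θ : ℝ) :
    fourier n (θ : AddCircle (2 * Real.pi)) = Complex.exp (Complex.I * n * θ) := by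
  have : (Real.pi : ℂ) ≠ 0 := by exact_mod_cast Real.pi_ne_zero
  rw [fourier_coe_apply]
  congr 1
  push_cast
  field_simp

theorem IsFourierMultiplier.solution_apply {L : EllTwo →L[ℂ] EllTwo}
    {σ : C(AddCircle (2 * Real.pi), ℂ)} (h : IsFourierMultiplier L σ) {ψ : ℝ → ℝ}
    (hσ : ∀ θ : ℝ, σ θ = ψ θ) {u : ℝ → EllTwo} (hu : IsSolution L e0 u) {t : ℝ} (ht : 0 ≤ t)
    (x : ℤ) :
    u t x = (1 / (2 * Real.pi) : ℂ) * ∫ θ in -Real.pi..Real.pi,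
      (Real.exp (-(t * ψ θ)) : ℂ) * Complex.exp (-(Complex.I * x * θ)) := by
  rw [hu.unique h.isSolution_exp ht, fourierSeq_apply,
    fourierCoeff_eq_intervalIntegral _ _ (-Real.pi), Complex.real_smul,
    show -Real.pi + 2 * Real.pi = Real.pi by ring]
  congr 1
  · push_cast; rfl
  refine intervalIntegral.integral_congr fun θ _ => ?_
  simp only [continuousMap_exp_apply, ContinuousMap.smul_apply, ContinuousMap.neg_apply, hσ,
    fourier_coe_two_pi, smul_eq_mul, Complex.real_smul]
  rw [mul_comm]
  congr 2 <;> push_cast <;> ring_nf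

/-! ### Large-time asymptotics -/

theorem exists_mul_abs_rpow_le {ψ : ℝ → ℝ} {α a R : ℝ} (ha : 0 < a)
    (hψ : ContinuousOn ψ (Set.Icc (-R) R)) (hpos : ∀ θ, θ ≠ 0 → |θ| ≤ R → 0 < ψ θ)
    (hlim : Tendsto (fun θ => ψ θ / |θ| ^ α) (𝓝[≠] 0) (𝓝 a)) :
    ∃ c : ℝ, 0 < c ∧ ∀ θ, θ ≠ 0 → |θ| ≤ R → c * |θ| ^ α ≤ ψ θ := by
  let q : ℝ → ℝ := Function.update (fun θ => ψ θ / |θ| ^ α) 0 a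
  have hq : ∀ θ, θ ≠ 0 → q θ = ψ θ / |θ| ^ α := fun θ hθ => Function.update_of_ne hθ _ _
  have hcont : ContinuousOn q (Set.Icc (-R) R) := by
    refine continuousOn_update_iff.2 ⟨(hψ.mono Set.sdiff_subset).div ?_ fun θ hθ => ?_,
      fun _ => hlim.mono_left (nhdsWithin_mono 0 fun θ hθ => hθ.2)⟩
    · exact continuous_abs.continuousOn.rpow_const fun θ hθ => .inl (abs_ne_zero.2 hθ.2)
    · exact (Real.rpow_pos_of_pos (abs_pos.2 hθ.2) α).ne'
  have hqpos : ∀ θ ∈ Set.Icc (-R) R, 0 < q θ := fun θ hθ => by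
    rcases eq_or_ne θ 0 with rfl | h0
    · simpa only [q, Function.update_self] using ha
    · have := hpos θ h0 (abs_le.2 hθ)
      rw [hq θ h0]
      positivity
  obtain ⟨c, hc, hle⟩ := isCompact_Icc.exists_forall_le' hcont hqpos
  refine ⟨c, hc, fun θ h0 hθ => ?_⟩
  rw [← le_div_iff₀ (by positivity), ← hq θ h0]
  exact hle θ (abs_le.1 hθ)

theorem integrable_exp_neg_mul_abs_rpow {α b : ℝ} (hα : 0 < α) (hb : 0 < b) :
    Integrable fun z : ℝ => Real.exp (-(b * |z| ^ α)) := by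
  have h : IntegrableOn (fun x : ℝ => Real.exp (-(b * x ^ α))) (Set.Ioi 0) := by
    simpa using integrableOn_rpow_mul_exp_neg_mul_rpow (s := 0) (by norm_num) hα hb
  refine (integrable_fun_norm_addHaar volume (f := fun r => Real.exp (-(b * r ^ α)))).2 ?_
  simpa using h

theorem exp_neg_abs_mul_rpow_eq (α : ℝ) {γ : ℝ} (hγ : 0 ≤ γ) (z : ℝ) :
    Real.exp (-|γ * z| ^ α) = Real.exp (-(γ ^ α * |z| ^ α)) := by
  rw [abs_mul, abs_of_nonneg hγ, Real.mul_rpow hγ (abs_nonneg _)]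

theorem norm_integral_mul_exp_sub_le {f g : ℝ → ℝ} (hf : Integrable f) (hg : Integrable g)
    (ξ : ℝ) :
    ‖(∫ z : ℝ, (f z : ℂ) * Complex.exp (-(Complex.I * ξ * z))) -
        ∫ z : ℝ, (g z : ℂ) * Complex.exp (-(Complex.I * ξ * z))‖ ≤ ∫ z, ‖f z - g z‖ := by
  have hexp : ∀ z : ℝ, ‖Complex.exp (-(Complex.I * ξ * z))‖ = 1 := fun z => by
    simp [Complex.norm_exp]
  have hint : ∀ {f : ℝ → ℝ}, Integrable f →
      Integrable fun z : ℝ => (f z : ℂ) * Complex.exp (-(Complex.I * ξ * z)) := fun hf =>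
    hf.ofReal.mul_bdd (c := 1) (by fun_prop) (.of_forall fun z => (hexp z).le)
  rw [← integral_sub (hint hf) (hint hg)]
  refine norm_integral_le_of_norm_le (hf.sub hg).norm (.of_forall fun z => ?_)
  rw [← sub_mul, norm_mul, hexp, mul_one, ← Complex.ofReal_sub, Complex.norm_real]

theorem stableDensity_symm_eq_integral (ξ α γ : ℝ) :
    (stableDensity ξ α 0 γ 0 : ℂ) = (1 / (2 * Real.pi) : ℂ) *
      ∫ z : ℝ, (Real.exp (-|γ * z| ^ α) : ℂ) * Complex.exp (-(Complex.I * ξ * z)) := by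
  rw [stableDensity_eq_integral, ← integral_neg_eq_self]
  simp [stableCharFun]

/-- The rescaled Fourier multiplier `e^{-l^{-α} ψ(l z)}`, cut off to `|l z| ≤ π`. At time
`t = l^{-α}` its Fourier transform is the rescaled solution. -/
def scaledMultiplier (ψ : ℝ → ℝ) (α l z : ℝ) : ℝ :=
  (Set.Icc (-Real.pi) Real.pi).indicator (fun θ => Real.exp (-(l ^ (-α) * ψ θ))) (l * z)

section ScaledMultiplier

variable {ψ : ℝ → ℝ} {α : ℝ}

theorem measurable_scaledMultiplier (hψ : Measurable ψ) (α l : ℝ) :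
    Measurable (scaledMultiplier ψ α l) :=
  (Measurable.indicator (by fun_prop) measurableSet_Icc).comp (measurable_const_mul l)

theorem norm_scaledMultiplier_le {c l z : ℝ} (hl : 0 < l) (hz : z ≠ 0)
    (hc : ∀ θ, θ ≠ 0 → |θ| ≤ Real.pi → c * |θ| ^ α ≤ ψ θ) :
    ‖scaledMultiplier ψ α l z‖ ≤ Real.exp (-(c * |z| ^ α)) := by
  unfold scaledMultiplier
  by_cases h : l * z ∈ Set.Icc (-Real.pi) Real.pi
  · rw [Set.indicator_of_mem h, Real.norm_of_nonneg (Real.exp_pos _).le, Real.exp_le_exp,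
      neg_le_neg_iff]
    calc c * |z| ^ α = l ^ (-α) * (c * |l * z| ^ α) := by
          rw [abs_mul, abs_of_pos hl, Real.mul_rpow hl.le (abs_nonneg _), Real.rpow_neg hl.le]
          field_simp
      _ ≤ l ^ (-α) * ψ (l * z) := by
          gcongr
          exact hc _ (mul_ne_zero hl.ne' hz) (abs_le.2 h)
  · rw [Set.indicator_of_notMem h, norm_zero]
    exact (Real.exp_pos _).le

theorem tendsto_scaledMultiplier {a z : ℝ} (hz : z ≠ 0)
    (hlim : Tendsto (fun θ => ψ θ / |θ| ^ α) (𝓝[≠] 0) (𝓝 a)) :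
    Tendsto (fun l => scaledMultiplier ψ α l z) (𝓝[>] 0) (𝓝 (Real.exp (-(a * |z| ^ α)))) := by
  have hz0 : Tendsto (fun l : ℝ => l * z) (𝓝[>] 0) (𝓝[≠] 0) := by
    refine tendsto_nhdsWithin_iff.2 ⟨?_, ?_⟩
    · exact ((continuous_mul_const z).tendsto' 0 0 (zero_mul z)).mono_left nhdsWithin_le_nhds
    · filter_upwards [self_mem_nhdsWithin] with l hl
      exact mul_ne_zero (ne_of_gt hl) hz
  have hmem : ∀ᶠ l : ℝ in 𝓝[>] 0, l * z ∈ Set.Icc (-Real.pi) Real.pi :=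
    (hz0.mono_right nhdsWithin_le_nhds).eventually
      (Icc_mem_nhds (by linarith [Real.pi_pos]) Real.pi_pos)
  refine Tendsto.congr' ?_
    ((Real.continuous_exp.tendsto _).comp ((hlim.comp hz0).mul_const (|z| ^ α)).neg)
  filter_upwards [hmem, self_mem_nhdsWithin] with l hl hl0
  have hl0 : 0 < l := hl0
  have : 0 < |z| := abs_pos.2 hz
  simp only [Function.comp_apply, scaledMultiplier, Set.indicator_of_mem hl]
  rw [abs_mul, abs_of_pos hl0, Real.mul_rpow hl0.le (abs_nonneg _), Real.rpow_neg hl0.le]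
  field_simp

theorem integrable_scaledMultiplier {c l : ℝ} (hψ : Measurable ψ) (hα : 0 < α) (hc0 : 0 < c)
    (hc : ∀ θ, θ ≠ 0 → |θ| ≤ Real.pi → c * |θ| ^ α ≤ ψ θ) (hl : 0 < l) :
    Integrable (scaledMultiplier ψ α l) := by
  refine (integrable_exp_neg_mul_abs_rpow hα hc0).mono'
    (measurable_scaledMultiplier hψ α l).aestronglyMeasurable ?_
  filter_upwards [Measure.ae_ne volume 0] with z hz using norm_scaledMultiplier_le hl hz hc

theorem tendsto_integral_scaledMultiplier_sub {a c : ℝ} (hψ : Measurable ψ) (hα : 0 < α)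
    (ha : 0 < a) (hc0 : 0 < c) (hc : ∀ θ, θ ≠ 0 → |θ| ≤ Real.pi → c * |θ| ^ α ≤ ψ θ)
    (hlim : Tendsto (fun θ => ψ θ / |θ| ^ α) (𝓝[≠] 0) (𝓝 a)) :
    Tendsto (fun l => ∫ z, ‖scaledMultiplier ψ α l z - Real.exp (-(a * |z| ^ α))‖) (𝓝[>] 0)
      (𝓝 0) := by
  refine (tendsto_integral_filter_of_dominated_convergence (f := fun _ => (0 : ℝ))
    (fun z => Real.exp (-(c * |z| ^ α)) + Real.exp (-(a * |z| ^ α))) ?_ ?_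
    ((integrable_exp_neg_mul_abs_rpow hα hc0).add (integrable_exp_neg_mul_abs_rpow hα ha))
    ?_).mono_right (by simp)
  · refine .of_forall fun l => ?_
    have := measurable_scaledMultiplier hψ α l
    fun_prop
  · filter_upwards [self_mem_nhdsWithin] with l hl
    filter_upwards [Measure.ae_ne volume 0] with z hz
    rw [norm_norm]
    refine (norm_sub_le _ _).trans (add_le_add (norm_scaledMultiplier_le hl hz hc) ?_)
    rw [Real.norm_of_nonneg (Real.exp_pos _).le]
  · filter_upwards [Measure.ae_ne volume 0] with z hz
    simpa using ((tendsto_scaledMultiplier hz hlim).sub_const (Real.exp (-(a * |z| ^ α)))).norm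

theorem integral_exp_neg_mul_exp_eq_scaledMultiplier {l : ℝ} (hl : 0 < l) (x : ℝ) :
    ∫ θ in -Real.pi..Real.pi,
      (Real.exp (-(l ^ (-α) * ψ θ)) : ℂ) * Complex.exp (-(Complex.I * x * θ)) =
    l * ∫ z : ℝ, (scaledMultiplier ψ α l z : ℂ) *
      Complex.exp (-(Complex.I * (l * x : ℝ) * z)) := by
  rw [intervalIntegral.integral_of_le (by linarith [Real.pi_pos]),
    ← integral_Icc_eq_integral_Ioc, ← integral_indicator measurableSet_Icc]
  set F : ℝ → ℂ := (Set.Icc (-Real.pi) Real.pi).indicator fun θ : ℝ =>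
    (Real.exp (-(l ^ (-α) * ψ θ)) : ℂ) * Complex.exp (-(Complex.I * x * θ))
  have hscale : ∀ z : ℝ, (scaledMultiplier ψ α l z : ℂ) *
      Complex.exp (-(Complex.I * (l * x : ℝ) * z)) = F (l * z) := fun z => by
    by_cases hz : l * z ∈ Set.Icc (-Real.pi) Real.pi
    · simp only [scaledMultiplier, F, Set.indicator_of_mem hz]
      congr 2
      push_cast
      ring
    · simp only [scaledMultiplier, F, Set.indicator_of_notMem hz, Complex.ofReal_zero, zero_mul]
  simp only [hscale, Measure.integral_comp_mul_left F l]
  rw [abs_of_pos (inv_pos.2 hl), ← Complex.real_smul, smul_inv_smul₀ hl.ne']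

end ScaledMultiplier

theorem norm_sub_stableDensity_le {L : EllTwo →L[ℂ] EllTwo} {σ : C(AddCircle (2 * Real.pi), ℂ)}
    (hL : IsFourierMultiplier L σ) {ψ : ℝ → ℝ} (hσ : ∀ θ : ℝ, σ θ = ψ θ) {u : ℝ → EllTwo}
    (hu : IsSolution L e0 u) {α γ l : ℝ} (hα : 0 < α) (hγ : 0 < γ) (hl : 0 < l)
    (hint : Integrable (scaledMultiplier ψ α l)) (x : ℤ) :
    ‖u (l ^ (-α)) x - (l * stableDensity (l * x) α 0 γ 0 : ℝ)‖ ≤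
      l * ∫ z, ‖scaledMultiplier ψ α l z - Real.exp (-(γ ^ α * |z| ^ α))‖ := by
  have hγα : 0 < γ ^ α := Real.rpow_pos_of_pos hγ α
  have hle := norm_integral_mul_exp_sub_le hint (integrable_exp_neg_mul_abs_rpow hα hγα) (l * x)
  have hx := integral_exp_neg_mul_exp_eq_scaledMultiplier (ψ := ψ) (α := α) hl x
  rw [Complex.ofReal_intCast] at hx
  have hpi : ‖(1 / (2 * Real.pi) : ℂ) * l‖ ≤ l := by
    have hle : 1 / (2 * Real.pi) ≤ 1 := by
      rw [div_le_one Real.two_pi_pos]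
      linarith [Real.pi_gt_three]
    have hnorm : ‖(1 / (2 * Real.pi) : ℂ) * l‖ = 1 / (2 * Real.pi) * l := by
      simp [abs_of_pos Real.pi_pos, abs_of_pos hl]
    rw [hnorm]
    exact mul_le_of_le_one_left hl.le hle
  rw [hL.solution_apply hσ hu (Real.rpow_nonneg hl.le _), Complex.ofReal_mul,
    stableDensity_symm_eq_integral]
  simp only [exp_neg_abs_mul_rpow_eq α hγ.le]
  rw [hx, mul_left_comm (l : ℂ) (1 / (2 * Real.pi) : ℂ), ← mul_assoc, ← mul_assoc, ← mul_sub,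
    norm_mul]
  exact mul_le_mul hpi hle (norm_nonneg _) hl.le

theorem IsFourierMultiplier.hasStableAsymptotics {L : EllTwo →L[ℂ] EllTwo}
    {σ : C(AddCircle (2 * Real.pi), ℂ)} (hL : IsFourierMultiplier L σ) {ψ : ℝ → ℝ}
    (hσ : ∀ θ : ℝ, σ θ = ψ θ) {α γ : ℝ} (hα : 0 < α) (hγ : 0 < γ)
    (hpos : ∀ θ, θ ≠ 0 → |θ| ≤ Real.pi → 0 < ψ θ)
    (hlim : Tendsto (fun θ => ψ θ / |θ| ^ α) (𝓝[≠] 0) (𝓝 (γ ^ α)))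
    {u : ℝ → EllTwo} (hu : IsSolution L e0 u) : HasStableAsymptotics u α γ := by
  have hψ : Continuous ψ := by
    have h : ψ = fun θ : ℝ => (σ (θ : AddCircle (2 * Real.pi))).re := by
      simp only [hσ, Complex.ofReal_re]
    rw [h]
    exact Complex.continuous_re.comp (σ.continuous.comp (AddCircle.continuous_mk' _))
  have hγα : 0 < γ ^ α := Real.rpow_pos_of_pos hγ α
  obtain ⟨c, hc0, hc⟩ := exists_mul_abs_rpow_le hγα hψ.continuousOn hpos hlim
  intro ε hε
  have hscale : Tendsto (fun t : ℝ => t ^ (-(1 / α))) atTop (𝓝[>] 0) := by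
    refine tendsto_nhdsWithin_iff.2 ⟨tendsto_rpow_neg_atTop (by positivity), ?_⟩
    filter_upwards [eventually_gt_atTop 0] with t ht using Real.rpow_pos_of_pos ht _
  have hsmall := ((tendsto_integral_scaledMultiplier_sub hψ.measurable hα hγα hc0 hc hlim).comp
    hscale).eventually (gt_mem_nhds hε)
  obtain ⟨T, hT⟩ := eventually_atTop.1 hsmall
  refine ⟨max T 1, by positivity, fun t ht x => ?_⟩
  have ht0 : 0 < t := one_pos.trans_le ((le_max_right _ _).trans ht)
  have hl : 0 < t ^ (-(1 / α)) := Real.rpow_pos_of_pos ht0 _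
  have hlt : (t ^ (-(1 / α))) ^ (-α) = t := by
    rw [← Real.rpow_mul ht0.le, show -(1 / α) * -α = 1 by field_simp, Real.rpow_one]
  have hle := norm_sub_stableDensity_le hL hσ hu hα hγ hl
    (integrable_scaledMultiplier hψ.measurable hα hc0 hc hl) x
  rw [hlt] at hle
  refine hle.trans ?_
  rw [mul_comm ε]
  exact mul_le_mul_of_nonneg_left (hT t ((le_max_left _ _).trans ht)).le hl.le

/-! ### The symbol of the Mellin-transformed Laplacian -/

/-- The symbol `2 - 2 cos(k θ)` of the `k`-path Laplacian as a continuous function on the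
circle. -/
def kPathCircleSymbol (k : ℕ) : C(AddCircle (2 * Real.pi), ℂ) :=
  (2 : ℂ) • 1 - fourier (-(k : ℤ)) - fourier (k : ℤ)

theorem isFourierMultiplier_kPathLaplacian (k : ℕ) :
    IsFourierMultiplier (kPathLaplacian k) (kPathCircleSymbol k) := fun g => by
  have h : kPathCircleSymbol k * g =
      (2 : ℂ) • g - fourier (-(k : ℤ)) * g - fourier (k : ℤ) * g := by
    simp [kPathCircleSymbol, sub_mul]
  ext n
  rw [h, map_sub, map_sub, map_smul, kPathLaplacian_apply, kPathMap_infinitePath]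
  change _ = 2 * fourierSeq g n - fourierSeq _ n - fourierSeq _ n
  simp only [fourierSeq_apply, fourierCoeff_fourier_mul, sub_neg_eq_add]

theorem norm_kPathCircleSymbol_le (k : ℕ) : ‖kPathCircleSymbol k‖ ≤ 4 := by
  refine (norm_sub_le _ _).trans ((add_le_add_left (norm_sub_le _ _) _).trans ?_)
  rw [fourier_norm, fourier_norm, norm_smul]
  norm_num

theorem kPathCircleSymbol_coe (k : ℕ) (θ : ℝ) :
    kPathCircleSymbol k (θ : AddCircle (2 * Real.pi)) =
      ((2 * (1 - Real.cos (k * θ)) : ℝ) : ℂ) := by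
  simp only [kPathCircleSymbol, ContinuousMap.sub_apply, ContinuousMap.smul_apply,
    ContinuousMap.one_apply, fourier_coe_two_pi]
  push_cast
  rw [Complex.cos]
  simp only [smul_eq_mul]
  ring_nf

/-- The symbol of the Mellin-transformed Laplacian as a continuous function on the circle; the
series converges uniformly for `s > 1`. -/
def mellinCircleSymbol (s : ℝ) : C(AddCircle (2 * Real.pi), ℂ) :=
  ∑' k : ℕ, ((1 / ((k : ℝ) + 1) ^ s : ℝ) : ℂ) • kPathCircleSymbol (k + 1)

/-- The symbol `∑_{k ≥ 1} k^{-s} (2 - 2 cos(k θ))` of the Mellin-transformed Laplacian as a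
function of the angle. -/
def mellinSymbol (s θ : ℝ) : ℝ :=
  ∑' k : ℕ, 1 / ((k : ℝ) + 1) ^ s * (2 * (1 - Real.cos (((k : ℝ) + 1) * θ)))

theorem mellinSymbol_neg (s θ : ℝ) : mellinSymbol s (-θ) = mellinSymbol s θ := by
  simp only [mellinSymbol, mul_neg, Real.cos_neg]

theorem summable_one_div_succ_rpow {s : ℝ} (hs : 1 < s) :
    Summable fun k : ℕ => 1 / ((k : ℝ) + 1) ^ s := by
  simpa using (summable_nat_add_iff 1).2 (Real.summable_one_div_nat_rpow.2 hs)

theorem hasSum_mellinCircleSymbol {s : ℝ} (hs : 1 < s) :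
    HasSum (fun k : ℕ => ((1 / ((k : ℝ) + 1) ^ s : ℝ) : ℂ) • kPathCircleSymbol (k + 1))
      (mellinCircleSymbol s) := by
  refine (Summable.of_norm_bounded ((summable_one_div_succ_rpow hs).mul_right 4)
    fun k => ?_).hasSum
  rw [norm_smul, Complex.norm_real, Real.norm_of_nonneg (by positivity)]
  exact mul_le_mul_of_nonneg_left (norm_kPathCircleSymbol_le _) (by positivity)

theorem isFourierMultiplier_mellinLaplacian {s : ℝ} (hs : 1 < s) :
    IsFourierMultiplier (mellinLaplacian s) (mellinCircleSymbol s) :=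
  .hasSum (fun _ => (isFourierMultiplier_kPathLaplacian _).const_smul _)
    (summable_mellinLaplacian hs).hasSum (hasSum_mellinCircleSymbol hs)

theorem hasSum_mellinSymbol {s : ℝ} (hs : 1 < s) (θ : ℝ) :
    HasSum (fun k : ℕ => 1 / ((k : ℝ) + 1) ^ s * (2 * (1 - Real.cos (((k : ℝ) + 1) * θ))))
      (mellinSymbol s θ) := by
  have h := ((hasSum_mellinCircleSymbol hs).mapL
    (ContinuousMap.evalCLM ℂ (θ : AddCircle (2 * Real.pi)))).mapL Complex.reCLM
  refine Summable.hasSum (h.summable.congr fun k => ?_)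
  simp only [ContinuousMap.evalCLM_apply, ContinuousMap.smul_apply, kPathCircleSymbol_coe,
    smul_eq_mul, Complex.reCLM_apply, Complex.re_ofReal_mul, Complex.ofReal_re]
  push_cast
  rfl

theorem mellinCircleSymbol_coe {s : ℝ} (hs : 1 < s) (θ : ℝ) :
    mellinCircleSymbol s (θ : AddCircle (2 * Real.pi)) = mellinSymbol s θ := by
  refine ((hasSum_mellinCircleSymbol hs).mapL
    (ContinuousMap.evalCLM ℂ (θ : AddCircle (2 * Real.pi)))).unique
    (((hasSum_mellinSymbol hs θ).mapL Complex.ofRealCLM).congr_fun fun k => ?_)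
  simp only [ContinuousMap.evalCLM_apply, ContinuousMap.smul_apply, kPathCircleSymbol_coe,
    smul_eq_mul, Complex.ofRealCLM_apply]
  push_cast
  rfl

theorem mellinSymbol_pos {s θ : ℝ} (hs : 1 < s) (h0 : θ ≠ 0) (hθ : |θ| ≤ Real.pi) :
    0 < mellinSymbol s θ := by
  have hcos : Real.cos θ ≠ 1 := by
    rw [abs_le] at hθ
    rwa [Ne, Real.cos_eq_one_iff_of_lt_of_lt (by linarith [Real.pi_pos])
      (by linarith [Real.pi_pos])]
  have hfirst := (hasSum_mellinSymbol hs θ).summable.le_tsum 0 fun k _ =>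
    mul_nonneg (by positivity) (by linarith [Real.cos_le_one (((k : ℝ) + 1) * θ)])
  simp only [Nat.cast_zero, zero_add, Real.one_rpow, div_one, one_mul] at hfirst
  have hlt := lt_of_le_of_ne (Real.cos_le_one θ) hcos
  exact lt_of_lt_of_le (by linarith) hfirst

theorem hasStableAsymptotics_of_tendsto_mellinSymbol {s α γ : ℝ} (hs : 1 < s) (hα : 0 < α)
    (hγ : 0 < γ) (hlim : Tendsto (fun θ => mellinSymbol s θ / |θ| ^ α) (𝓝[≠] 0) (𝓝 (γ ^ α)))
    {u : ℝ → EllTwo} (hu : IsSolution (mellinLaplacian s) e0 u) : HasStableAsymptotics u α γ :=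
  (isFourierMultiplier_mellinLaplacian hs).hasStableAsymptotics (mellinCircleSymbol_coe hs) hα hγ
    (fun _ h0 hθ => mellinSymbol_pos hs h0 hθ) hlim hu

/-! ### The symbol near the origin: finite second moment -/

theorem two_mul_one_sub_cos_eq (x : ℝ) :
    2 * (1 - Real.cos x) = x ^ 2 * Real.sinc (x / 2) ^ 2 := by
  rcases eq_or_ne x 0 with rfl | hx
  · simp
  have h := Real.sin_sq_eq_half_sub (x / 2)
  rw [Real.sinc_of_ne_zero (by positivity), div_pow, h, mul_div_cancel₀ x two_ne_zero]
  field_simp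

theorem tendsto_tsum_mul_one_sub_cos_div_sq {ι : Type*} {a c : ι → ℝ}
    (h : Summable fun i => a i * c i ^ 2) :
    Tendsto (fun θ => (∑' i, a i * (2 * (1 - Real.cos (c i * θ)))) / θ ^ 2) (𝓝[≠] 0)
      (𝓝 (∑' i, a i * c i ^ 2)) := by
  have key : Tendsto (fun θ => ∑' i, a i * c i ^ 2 * Real.sinc (c i * θ / 2) ^ 2) (𝓝[≠] 0)
      (𝓝 (∑' i, a i * c i ^ 2)) := by
    refine tendsto_tsum_of_dominated_convergence h.norm (fun i => ?_) (.of_forall fun θ i => ?_)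
    · have hc : Continuous fun θ : ℝ => a i * c i ^ 2 * Real.sinc (c i * θ / 2) ^ 2 := by
        have := Real.continuous_sinc
        fun_prop
      exact (hc.tendsto' 0 _ (by simp)).mono_left nhdsWithin_le_nhds
    · rw [norm_mul, norm_pow (Real.sinc _)]
      exact mul_le_of_le_one_right (norm_nonneg _)
        (pow_le_one₀ (norm_nonneg _) (Real.abs_sinc_le_one _))
  refine key.congr' ?_
  filter_upwards [self_mem_nhdsWithin] with θ hθ
  have hθ : θ ≠ 0 := hθ
  rw [← tsum_div_const]
  refine tsum_congr fun i => ?_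
  rw [two_mul_one_sub_cos_eq]
  field_simp

theorem re_riemannZeta_eq_tsum {σ : ℝ} (hσ : 1 < σ) :
    (riemannZeta (σ : ℂ)).re = ∑' k : ℕ, 1 / ((k : ℝ) + 1) ^ σ := by
  rw [zeta_eq_tsum_one_div_nat_add_one_cpow (by simpa using hσ), ← Complex.ofReal_re (∑' k : ℕ, _),
    Complex.ofReal_tsum]
  congr 2
  funext k
  rw [Complex.ofReal_div, Complex.ofReal_cpow (by positivity)]
  push_cast
  rfl

theorem tendsto_mellinSymbol_div_sq {s : ℝ} (hs : 3 < s) :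
    Tendsto (fun θ => mellinSymbol s θ / |θ| ^ (2 : ℝ)) (𝓝[≠] 0)
      (𝓝 (riemannZeta ((s : ℂ) - 2)).re) := by
  have hterm : ∀ k : ℕ, 1 / ((k : ℝ) + 1) ^ s * ((k : ℝ) + 1) ^ 2 = 1 / ((k : ℝ) + 1) ^ (s - 2) :=
    fun k => by
      have hk : (0 : ℝ) < k + 1 := by positivity
      rw [Real.rpow_sub hk, Real.rpow_two]
      field_simp
  have hsum := summable_one_div_succ_rpow (s := s - 2) (by linarith)
  simp only [← hterm] at hsum
  have h := tendsto_tsum_mul_one_sub_cos_div_sq hsum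
  simp only [hterm, ← re_riemannZeta_eq_tsum (σ := s - 2) (by linarith)] at h
  simpa only [mellinSymbol, Real.rpow_two, sq_abs, Complex.ofReal_sub, Complex.ofReal_ofNat]
    using h

/-! ### The symbol near the origin: heavy tails -/

/-- The right endpoint of the cell `[θ k, θ (k + 1))` of the grid `θ ℕ` that contains `y ≥ 0`. -/
def gridPoint (θ y : ℝ) : ℝ := θ * (⌊y / θ⌋₊ + 1)

theorem le_gridPoint {θ : ℝ} (hθ : 0 < θ) (y : ℝ) : y ≤ gridPoint θ y := by
  have h := Nat.lt_floor_add_one (y / θ)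
  rw [div_lt_iff₀ hθ, mul_comm] at h
  exact h.le

theorem gridPoint_le {θ y : ℝ} (hθ : 0 < θ) (hy : 0 ≤ y) : gridPoint θ y ≤ y + θ := by
  have h := Nat.floor_le (show 0 ≤ y / θ by positivity)
  rw [le_div_iff₀ hθ, mul_comm] at h
  rw [gridPoint, mul_add, mul_one]
  gcongr

theorem gridPoint_eq {θ y : ℝ} {k : ℕ} (hθ : 0 < θ) (hy : y ∈ Set.Ico (θ * k) (θ * (k + 1))) :
    gridPoint θ y = θ * (k + 1) := by
  have hy0 : 0 ≤ y := le_trans (by positivity) hy.1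
  have hfloor : ⌊y / θ⌋₊ = k := by
    rw [Nat.floor_eq_iff (by positivity), le_div_iff₀' hθ, div_lt_iff₀' hθ]
    exact hy
  rw [gridPoint, hfloor]

theorem tendsto_gridPoint {y : ℝ} (hy : 0 ≤ y) :
    Tendsto (fun θ => gridPoint θ y) (𝓝[>] 0) (𝓝 y) := by
  refine tendsto_of_tendsto_of_tendsto_of_le_of_le' tendsto_const_nhds (h := fun θ => y + θ)
    (((continuous_const_add y).tendsto' 0 y (add_zero y)).mono_left nhdsWithin_le_nhds) ?_ ?_
  · filter_upwards [self_mem_nhdsWithin] with θ hθ using le_gridPoint hθ y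
  · filter_upwards [self_mem_nhdsWithin] with θ hθ using gridPoint_le hθ hy

theorem stronglyMeasurable_comp_gridPoint {E : Type*} [TopologicalSpace E] (h : ℝ → E) (θ : ℝ) :
    StronglyMeasurable fun y => h (gridPoint θ y) :=
  (StronglyMeasurable.of_discrete (f := fun k : ℕ => h (θ * (k + 1)))).comp_measurable
    (Nat.measurable_floor.comp (measurable_id.div_const θ))

section RiemannSum

variable {E : Type*} [NormedAddCommGroup E] [NormedSpace ℝ E] [CompleteSpace E] {h : ℝ → E}

theorem hasSum_integral_comp_gridPoint {θ : ℝ} (hθ : 0 < θ)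
    (hint : IntegrableOn (fun y => h (gridPoint θ y)) (Set.Ioi 0)) :
    HasSum (fun k : ℕ => θ • h (θ * (k + 1))) (∫ y in Set.Ioi 0, h (gridPoint θ y)) := by
  have hunion : (⋃ k : ℕ, Set.Ico (θ * k) (θ * (k + 1))) = Set.Ici 0 := by
    refine Set.Subset.antisymm
      (Set.iUnion_subset fun k y hy => le_trans (by positivity) hy.1) fun y hy => ?_
    have hy : 0 ≤ y / θ := div_nonneg hy hθ.le
    refine Set.mem_iUnion.2 ⟨⌊y / θ⌋₊, ?_⟩
    rw [Set.mem_Ico, ← le_div_iff₀' hθ, ← div_lt_iff₀' hθ]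
    exact ⟨Nat.floor_le hy, Nat.lt_floor_add_one _⟩
  have hdisj : Pairwise (Function.onFun Disjoint fun k : ℕ => Set.Ico (θ * k) (θ * (k + 1))) := by
    have hmono : Monotone fun k : ℕ => θ * k := fun _ _ hk => by dsimp only; gcongr
    simpa using hmono.pairwise_disjoint_on_Ico_succ
  have hsum := hasSum_integral_iUnion (f := fun y => h (gridPoint θ y)) (fun _ => measurableSet_Ico)
    hdisj (by rw [hunion]; exact Iff.mpr integrableOn_Ici_iff_integrableOn_Ioi hint)
  rw [hunion, integral_Ici_eq_integral_Ioi] at hsum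
  refine hsum.congr_fun fun k => ?_
  rw [setIntegral_congr_fun measurableSet_Ico fun y hy => congrArg h (gridPoint_eq hθ hy),
    setIntegral_const, measureReal_def, Real.volume_Ico, mul_add, mul_one, add_sub_cancel_left,
    ENNReal.toReal_ofReal hθ.le]

theorem tendsto_riemannSum_Ioi {B : ℝ → ℝ} (hcont : ContinuousOn h (Set.Ioi 0))
    (hB : IntegrableOn B (Set.Ioi 0))
    (hle : ∀ y r, 0 < y → y ≤ r → r ≤ y + 1 → ‖h r‖ ≤ B y) :
    Tendsto (fun θ => ∑' k : ℕ, θ • h (θ * (k + 1))) (𝓝[>] 0) (𝓝 (∫ y in Set.Ioi 0, h y)) := by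
  have hsmall : ∀ᶠ θ : ℝ in 𝓝[>] 0, 0 < θ ∧ θ ≤ 1 :=
    (eventually_mem_nhdsWithin).and (mem_nhdsWithin_of_mem_nhds (Iic_mem_nhds one_pos))
  have hbound : ∀ᶠ θ : ℝ in 𝓝[>] 0, ∀ᵐ y ∂volume.restrict (Set.Ioi 0),
      ‖h (gridPoint θ y)‖ ≤ B y := by
    filter_upwards [hsmall] with θ hθ
    filter_upwards [ae_restrict_mem measurableSet_Ioi] with y hy
    exact hle y _ hy (le_gridPoint hθ.1 y)
      ((gridPoint_le hθ.1 (le_of_lt hy)).trans (by linarith [hθ.2]))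
  refine Tendsto.congr' ?_ (tendsto_integral_filter_of_dominated_convergence B
    (.of_forall fun θ => (stronglyMeasurable_comp_gridPoint h θ).aestronglyMeasurable)
    hbound hB ?_)
  · filter_upwards [hsmall, hbound] with θ hθ hb
    exact (hasSum_integral_comp_gridPoint hθ.1 (hB.mono'
      (stronglyMeasurable_comp_gridPoint h θ).aestronglyMeasurable hb)).tsum_eq.symm
  · filter_upwards [ae_restrict_mem measurableSet_Ioi] with y hy
    exact (hcont.continuousAt (Ioi_mem_nhds hy)).tendsto.comp (tendsto_gridPoint (le_of_lt hy))

end RiemannSum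

theorem two_mul_one_sub_cos_nonneg (x : ℝ) : 0 ≤ 2 * (1 - Real.cos x) := by
  linarith [Real.cos_le_one x]

theorem two_mul_one_sub_cos_mul_rpow_le_rpow {r : ℝ} (hr : 0 < r) (s : ℝ) :
    2 * (1 - Real.cos r) * r ^ (-s) ≤ r ^ (2 - s) := by
  rw [sub_eq_add_neg 2 s, Real.rpow_add hr, Real.rpow_two]
  gcongr
  linarith [Real.one_sub_sq_div_two_le_cos (x := r)]

/-- An integrable function of `y > 0` that dominates `2 (1 - cos r) r ^ (-s)` for all `r` between
`y` and `y + 1`. -/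
def oneSubCosBound (s y : ℝ) : ℝ := if y ≤ 1 then y ^ (2 - s) + 2 else 4 * y ^ (-s)

theorem integrableOn_oneSubCosBound {s : ℝ} (hs : 1 < s) (hs3 : s < 3) :
    IntegrableOn (oneSubCosBound s) (Set.Ioi 0) := by
  rw [← Set.Ioc_union_Ioi_eq_Ioi zero_le_one]
  refine IntegrableOn.union ?_ ?_
  · refine IntegrableOn.congr_fun ?_ (fun y hy => (if_pos hy.2).symm) measurableSet_Ioc
    rw [← intervalIntegrable_iff_integrableOn_Ioc_of_le zero_le_one]
    exact (intervalIntegral.intervalIntegrable_rpow' (by linarith)).add intervalIntegrable_const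
  · refine IntegrableOn.congr_fun ?_ (fun y hy => (if_neg (not_le.2 hy)).symm) measurableSet_Ioi
    exact (integrableOn_Ioi_rpow_of_lt (by linarith) one_pos).const_mul 4

theorem le_oneSubCosBound {s y r : ℝ} (hs : 1 < s) (hy : 0 < y) (hr : y ≤ r) (hr1 : r ≤ y + 1) :
    2 * (1 - Real.cos r) * r ^ (-s) ≤ oneSubCosBound s y := by
  have hr0 : 0 < r := hy.trans_le hr
  unfold oneSubCosBound
  split_ifs with h
  · refine (two_mul_one_sub_cos_mul_rpow_le_rpow hr0 s).trans ?_
    rcases le_or_gt s 2 with h2 | h2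
    · have hle : r ^ (2 - s) ≤ 2 :=
        calc r ^ (2 - s) ≤ 2 ^ (2 - s) := by gcongr; linarith
          _ ≤ 2 ^ (1 : ℝ) := Real.rpow_le_rpow_of_exponent_le one_le_two (by linarith)
          _ = 2 := Real.rpow_one 2
      exact hle.trans (le_add_of_nonneg_left (by positivity))
    · have hle := Real.rpow_le_rpow_of_nonpos hy hr (by linarith : 2 - s ≤ 0)
      linarith
  · have hcos : 2 * (1 - Real.cos r) ≤ 4 := by linarith [Real.neg_one_le_cos r]
    exact mul_le_mul hcos (Real.rpow_le_rpow_of_nonpos hy hr (by linarith)) (by positivity)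
      (by norm_num)

theorem norm_two_mul_one_sub_cos_mul_rpow_le {s y r : ℝ} (hs : 1 < s) (hy : 0 < y) (hr : y ≤ r)
    (hr1 : r ≤ y + 1) : ‖2 * (1 - Real.cos r) * r ^ (-s)‖ ≤ oneSubCosBound s y := by
  have hr0 : 0 < r := hy.trans_le hr
  rw [Real.norm_of_nonneg (mul_nonneg (two_mul_one_sub_cos_nonneg r) (by positivity))]
  exact le_oneSubCosBound hs hy hr hr1

theorem integrableOn_two_mul_one_sub_cos_mul_rpow {s : ℝ} (hs : 1 < s) (hs3 : s < 3) :
    IntegrableOn (fun y : ℝ => 2 * (1 - Real.cos y) * y ^ (-s)) (Set.Ioi 0) := by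
  refine (integrableOn_oneSubCosBound hs hs3).mono'
    (by fun_prop : Measurable _).aestronglyMeasurable ?_
  filter_upwards [ae_restrict_mem measurableSet_Ioi] with y hy
  exact norm_two_mul_one_sub_cos_mul_rpow_le hs hy le_rfl (by linarith)

theorem tendsto_mellinSymbol_div_rpow {s : ℝ} (hs : 1 < s) (hs3 : s < 3) :
    Tendsto (fun θ => mellinSymbol s θ / |θ| ^ (s - 1)) (𝓝[≠] 0)
      (𝓝 (∫ y in Set.Ioi 0, 2 * (1 - Real.cos y) * y ^ (-s))) := by
  have hcont : ContinuousOn (fun y : ℝ => 2 * (1 - Real.cos y) * y ^ (-s)) (Set.Ioi 0) :=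
    ContinuousOn.mul (by fun_prop)
      (continuousOn_id.rpow_const fun y hy => .inl (ne_of_gt hy))
  have hsum := tendsto_riemannSum_Ioi hcont (integrableOn_oneSubCosBound hs hs3)
    fun y r hy hr hr1 => norm_two_mul_one_sub_cos_mul_rpow_le hs hy hr hr1
  have hpos : Tendsto (fun θ => mellinSymbol s θ / θ ^ (s - 1)) (𝓝[>] 0)
      (𝓝 (∫ y in Set.Ioi 0, 2 * (1 - Real.cos y) * y ^ (-s))) := by
    refine hsum.congr' ?_
    filter_upwards [self_mem_nhdsWithin] with θ hθ
    have hθ : 0 < θ := hθ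
    rw [mellinSymbol, ← tsum_div_const]
    refine tsum_congr fun k => ?_
    have hk : (0 : ℝ) < (k : ℝ) + 1 := by positivity
    rw [smul_eq_mul, Real.mul_rpow hθ.le hk.le, Real.rpow_sub hθ, Real.rpow_one,
      Real.rpow_neg hθ.le, Real.rpow_neg hk.le, mul_comm θ ((k : ℝ) + 1)]
    field_simp
  refine (hpos.comp tendsto_abs_nhdsNE_zero).congr fun θ => ?_
  have habs : mellinSymbol s |θ| = mellinSymbol s θ := by
    rcases abs_choice θ with h | h <;> simp only [h, mellinSymbol_neg]
  rw [Function.comp_apply, habs]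

/-! ### The constant -/

theorem integral_rpow_mul_exp_neg_mul {s y : ℝ} (hs : 0 < s) (hy : 0 < y) :
    ∫ x in Set.Ioi 0, x ^ (s - 1) * Real.exp (-(y * x)) = Real.Gamma s * y ^ (-s) := by
  rw [Real.integral_rpow_mul_exp_neg_mul_Ioi hs hy, Real.rpow_neg hy.le, one_div,
    Real.inv_rpow hy.le, mul_comm]

theorem integrable_mul_rpow_mul_exp_neg {g : ℝ → ℝ} {s : ℝ} (hs : 0 < s)
    (hg : IntegrableOn (fun y => g y * y ^ (-s)) (Set.Ioi 0)) :
    Integrable (Function.uncurry fun y x : ℝ => g y * (x ^ (s - 1) * Real.exp (-(y * x))))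
      ((volume.restrict (Set.Ioi 0)).prod (volume.restrict (Set.Ioi 0))) := by
  have hgm : AEStronglyMeasurable g (volume.restrict (Set.Ioi 0)) := by
    refine (hg.aestronglyMeasurable.mul
      (by fun_prop : Measurable fun y : ℝ => y ^ s).aestronglyMeasurable).congr ?_
    filter_upwards [ae_restrict_mem measurableSet_Ioi] with y hy
    have hy : 0 < y := hy
    rw [Pi.mul_apply, mul_assoc, ← Real.rpow_add hy, neg_add_cancel, Real.rpow_zero, mul_one]
  have hnorm : ∀ y ∈ Set.Ioi (0 : ℝ), Real.Gamma s * ‖g y * y ^ (-s)‖ =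
      ∫ x in Set.Ioi 0, ‖g y * (x ^ (s - 1) * Real.exp (-(y * x)))‖ := fun y hy => by
    have hy : 0 < y := hy
    have h : ∀ x ∈ Set.Ioi (0 : ℝ), ‖g y * (x ^ (s - 1) * Real.exp (-(y * x)))‖ =
        ‖g y‖ * (x ^ (s - 1) * Real.exp (-(y * x))) := fun x hx => by
      have hx : 0 < x := hx
      rw [norm_mul, Real.norm_of_nonneg
        (by positivity : 0 ≤ x ^ (s - 1) * Real.exp (-(y * x)))]
    rw [setIntegral_congr_fun measurableSet_Ioi h, integral_const_mul,
      integral_rpow_mul_exp_neg_mul hs hy, norm_mul,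
      Real.norm_of_nonneg (by positivity : 0 ≤ y ^ (-s)), mul_left_comm]
  refine (integrable_prod_iff (hgm.comp_fst.mul
    (by fun_prop : Measurable _).aestronglyMeasurable)).2
    ⟨?_, IntegrableOn.congr_fun (hg.norm.const_mul _) hnorm measurableSet_Ioi⟩
  filter_upwards [ae_restrict_mem measurableSet_Ioi] with y hy
  have h := integrableOn_rpow_mul_exp_neg_mul_rpow (s := s - 1) (by linarith) one_pos hy
  simp only [Real.rpow_one, neg_mul] at h
  exact h.const_mul (g y)

-- This reduces the two integrals below to Gamma functions: `1 / (1 + x)` and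
-- `1 / (x * (1 + x ^ 2))` are the Laplace transforms of `exp (-y)` and `1 - cos y`.
theorem integral_rpow_mul_integral_mul_exp_neg {g : ℝ → ℝ} {s : ℝ} (hs : 0 < s)
    (hg : IntegrableOn (fun y => g y * y ^ (-s)) (Set.Ioi 0)) :
    ∫ x in Set.Ioi 0, x ^ (s - 1) * ∫ y in Set.Ioi 0, g y * Real.exp (-(x * y)) =
      Real.Gamma s * ∫ y in Set.Ioi 0, g y * y ^ (-s) := by
  have hswap := integral_integral_swap (integrable_mul_rpow_mul_exp_neg hs hg)
  have hinner : ∀ y ∈ Set.Ioi (0 : ℝ),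
      ∫ x in Set.Ioi 0, g y * (x ^ (s - 1) * Real.exp (-(y * x))) =
        Real.Gamma s * (g y * y ^ (-s)) := fun y hy => by
    rw [integral_const_mul, integral_rpow_mul_exp_neg_mul hs hy, mul_left_comm]
  rw [setIntegral_congr_fun measurableSet_Ioi hinner, integral_const_mul] at hswap
  rw [hswap]
  congr with x
  rw [← integral_const_mul]
  congr with y
  rw [mul_comm x y, mul_left_comm]

theorem integral_rpow_div_one_add {a : ℝ} (ha : 0 < a) (ha1 : a < 1) :
    ∫ x in Set.Ioi (0 : ℝ), x ^ (a - 1) / (1 + x) = Real.pi / Real.sin (Real.pi * a) := by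
  have hΓ : IntegrableOn (fun y : ℝ => Real.exp (-y) * y ^ (-a)) (Set.Ioi 0) := by
    have h := Real.GammaIntegral_convergent (sub_pos.2 ha1)
    rwa [(by ring : 1 - a - 1 = -a)] at h
  have hlaplace : ∀ x ∈ Set.Ioi (0 : ℝ),
      ∫ y in Set.Ioi 0, Real.exp (-y) * Real.exp (-(x * y)) = 1 / (1 + x) := fun x hx => by
    have hx : 0 < x := hx
    have h := integral_exp_mul_Ioi (neg_lt_zero.2 (by positivity : 0 < 1 + x)) 0
    rw [mul_zero, Real.exp_zero, neg_div_neg_eq] at h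
    rw [← h]
    congr with y
    rw [← Real.exp_add]
    ring_nf
  calc ∫ x in Set.Ioi (0 : ℝ), x ^ (a - 1) / (1 + x)
    _ = ∫ x in Set.Ioi 0, x ^ (a - 1) *
          ∫ y in Set.Ioi 0, Real.exp (-y) * Real.exp (-(x * y)) :=
      setIntegral_congr_fun measurableSet_Ioi fun x hx => by
        simp only [hlaplace x hx, mul_one_div]
    _ = Real.Gamma a * ∫ y in Set.Ioi 0, Real.exp (-y) * y ^ (-a) :=
      integral_rpow_mul_integral_mul_exp_neg ha hΓ
    _ = Real.Gamma a * Real.Gamma (1 - a) := by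
      rw [Real.Gamma_eq_integral (sub_pos.2 ha1), (by ring : 1 - a - 1 = -a)]
    _ = Real.pi / Real.sin (Real.pi * a) := Real.Gamma_mul_Gamma_one_sub a

theorem integral_rpow_div_one_add_sq {a : ℝ} (ha : 0 < a) (ha2 : a < 2) :
    ∫ x in Set.Ioi (0 : ℝ), x ^ (a - 1) / (1 + x ^ 2) =
      Real.pi / (2 * Real.sin (Real.pi * a / 2)) := by
  have h := integral_comp_rpow_Ioi_of_pos (g := fun x : ℝ => x ^ (a / 2 - 1) / (1 + x)) two_pos
  rw [integral_rpow_div_one_add (by linarith) (by linarith), ← mul_div_assoc] at h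
  have hcomp : ∀ x ∈ Set.Ioi (0 : ℝ), (2 * x ^ ((2 : ℝ) - 1)) •
      ((x ^ (2 : ℝ)) ^ (a / 2 - 1) / (1 + x ^ (2 : ℝ))) = 2 * (x ^ (a - 1) / (1 + x ^ 2)) :=
    fun x hx => by
      have hx : 0 < x := hx
      rw [← Real.rpow_mul hx.le, (by ring : (2 : ℝ) * (a / 2 - 1) = a - 1 - 1),
        Real.rpow_sub_one hx.ne' (a - 1), Real.rpow_two, smul_eq_mul]
      norm_num
      field_simp
  rw [setIntegral_congr_fun measurableSet_Ioi hcomp, integral_const_mul] at h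
  rw [mul_comm 2 (Real.sin _), ← div_div, ← h, mul_div_cancel_left₀ _ two_ne_zero]

theorem integral_one_sub_cos_mul_exp_neg {x : ℝ} (hx : 0 < x) :
    ∫ y in Set.Ioi 0, (1 - Real.cos y) * Real.exp (-(x * y)) = 1 / (x * (1 + x ^ 2)) := by
  have hneg : (-(x : ℂ) + Complex.I).re < 0 := by simpa using hx
  have hre : ∀ y : ℝ, (Complex.exp ((-(x : ℂ) + Complex.I) * y)).re =
      Real.cos y * Real.exp (-x * y) := fun y => by
    rw [Complex.exp_re]
    simp [mul_comm]
  have hcosInt : IntegrableOn (fun y => Real.cos y * Real.exp (-x * y)) (Set.Ioi 0) := by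
    have h := Complex.reCLM.integrable_comp (integrableOn_exp_mul_complex_Ioi hneg 0)
    simp only [Complex.reCLM_apply, hre] at h
    exact h
  have hcos : ∫ y in Set.Ioi 0, Real.cos y * Real.exp (-x * y) = x / (1 + x ^ 2) := by
    have h := congrArg Complex.re (integral_exp_mul_complex_Ioi hneg 0)
    rw [← Complex.reCLM_apply, ← ContinuousLinearMap.integral_comp_comm _
      (integrableOn_exp_mul_complex_Ioi hneg 0)] at h
    simp only [Complex.reCLM_apply, hre] at h
    rw [h]
    simp [Complex.normSq_apply, Complex.div_re]
    ring_nf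
  have hsplit : ∀ y : ℝ, (1 - Real.cos y) * Real.exp (-(x * y)) =
      Real.exp (-x * y) - Real.cos y * Real.exp (-x * y) := fun y => by
    rw [neg_mul]; ring
  simp only [hsplit]
  rw [integral_sub (integrableOn_exp_mul_Ioi (neg_lt_zero.2 hx) 0) hcosInt, hcos,
    integral_exp_mul_Ioi (neg_lt_zero.2 hx) 0, mul_zero, Real.exp_zero]
  field_simp
  ring

theorem integral_one_sub_cos_mul_rpow {s : ℝ} (hs : 1 < s) (hs3 : s < 3) :
    ∫ y in Set.Ioi 0, 2 * (1 - Real.cos y) * y ^ (-s) =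
      -(Real.pi / (Real.Gamma s * Real.cos (Real.pi * s / 2))) := by
  have hΓ := (Real.Gamma_pos_of_pos (zero_lt_one.trans hs)).ne'
  have hlaplace : ∀ x ∈ Set.Ioi (0 : ℝ), x ^ (s - 1) *
      ∫ y in Set.Ioi 0, 2 * (1 - Real.cos y) * Real.exp (-(x * y)) =
        2 * (x ^ (s - 1 - 1) / (1 + x ^ 2)) := fun x hx => by
    have hx : 0 < x := hx
    simp only [mul_assoc (2 : ℝ)]
    rw [integral_const_mul, integral_one_sub_cos_mul_exp_neg hx, Real.rpow_sub_one hx.ne' (s - 1)]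
    field_simp
  have hsin : Real.sin (Real.pi * (s - 1) / 2) = -Real.cos (Real.pi * s / 2) := by
    rw [← Real.sin_sub_pi_div_two]
    ring_nf
  have h := integral_rpow_mul_integral_mul_exp_neg (zero_lt_one.trans hs)
    (integrableOn_two_mul_one_sub_cos_mul_rpow hs hs3)
  rw [setIntegral_congr_fun measurableSet_Ioi hlaplace, integral_const_mul,
    integral_rpow_div_one_add_sq (sub_pos.2 hs) (by linarith), hsin] at h
  rw [← mul_right_inj' hΓ, ← h]
  field_simp

/-! ### Rotating rays of integration -/

section Exp

variable {E : Type*} [NormedAddCommGroup E] [NormedSpace ℝ E]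

theorem exp_image_univ : Real.exp '' Set.univ = Set.Ioi 0 := by
  rw [Set.image_univ, Real.range_exp]

theorem integral_Ioi_eq_integral_exp_smul (f : ℝ → E) :
    ∫ r in Set.Ioi 0, f r = ∫ x, Real.exp x • f (Real.exp x) := by
  have h := integral_image_eq_integral_abs_deriv_smul MeasurableSet.univ
    (fun x _ => (Real.hasDerivAt_exp x).hasDerivWithinAt) Real.exp_injective.injOn f
  simpa only [exp_image_univ, Measure.restrict_univ, Real.abs_exp] using h

theorem integrableOn_Ioi_iff_integrable_exp_smul {f : ℝ → E} :
    IntegrableOn f (Set.Ioi 0) ↔ Integrable fun x => Real.exp x • f (Real.exp x) := by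
  have h := integrableOn_image_iff_integrableOn_abs_deriv_smul MeasurableSet.univ
    (fun x _ => (Real.hasDerivAt_exp x).hasDerivWithinAt) Real.exp_injective.injOn f
  simpa only [exp_image_univ, integrableOn_univ, Real.abs_exp] using h

end Exp

section Rotation

variable {E : Type*} [NormedAddCommGroup E] [NormedSpace ℂ E] {a b : ℝ}

theorem tendsto_integral_vertical {G : ℂ → E} {B : ℝ → ℝ} {φ : ℝ → ℝ}
    (hle : ∀ x : ℝ, ∀ y ∈ Set.uIcc a b, ‖G (x + y * Complex.I)‖ ≤ B x)
    (hB : Tendsto (fun R => B (φ R)) atTop (𝓝 0)) :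
    Tendsto (fun R => ∫ y : ℝ in a..b, G (φ R + y * Complex.I)) atTop (𝓝 0) := by
  refine squeeze_zero_norm (fun R => intervalIntegral.norm_integral_le_of_norm_le_const
    fun y hy => hle (φ R) y (Set.uIoc_subset_uIcc hy)) ?_
  simpa using hB.mul_const |b - a|

theorem integral_add_mul_I_eq_of_norm_le {G : ℂ → E} {B : ℝ → ℝ}
    (hG : DifferentiableOn ℂ G (Set.univ ×ℂ Set.uIcc a b)) (hB : Integrable B)
    (hbot : Tendsto B atBot (𝓝 0)) (htop : Tendsto B atTop (𝓝 0))
    (hle : ∀ x : ℝ, ∀ y ∈ Set.uIcc a b, ‖G (x + y * Complex.I)‖ ≤ B x) :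
    ∫ x : ℝ, G (x + a * Complex.I) = ∫ x : ℝ, G (x + b * Complex.I) := by
  have hlim : ∀ y ∈ Set.uIcc a b, Tendsto (fun R : ℝ => ∫ x : ℝ in -R..R, G (x + y * Complex.I))
      atTop (𝓝 (∫ x : ℝ, G (x + y * Complex.I))) := fun y hy => by
    refine intervalIntegral_tendsto_integral (hB.mono' ?_ (.of_forall fun x => hle x y hy))
      tendsto_neg_atTop_atBot tendsto_id
    refine (hG.continuousOn.comp_continuous (by fun_prop) fun x => ?_).aestronglyMeasurable
    simpa [Complex.mem_reProdIm] using hy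
  have hright := tendsto_integral_vertical hle htop
  have hleft := tendsto_integral_vertical hle (hbot.comp tendsto_neg_atTop_atBot)
  have hrect : ∀ R : ℝ, (∫ x : ℝ in -R..R, G (x + a * Complex.I)) -
      (∫ x : ℝ in -R..R, G (x + b * Complex.I)) +
      Complex.I • (∫ y : ℝ in a..b, G (R + y * Complex.I)) -
      Complex.I • (∫ y : ℝ in a..b, G ((-R : ℝ) + y * Complex.I)) = 0 := fun R =>
    Complex.integral_boundary_rect_eq_zero_of_differentiableOn G ⟨-R, a⟩ ⟨R, b⟩
      (hG.mono fun _ hw => ⟨Set.mem_univ _, hw.2⟩)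
  have hsum := (((hlim a Set.left_mem_uIcc).sub (hlim b Set.right_mem_uIcc)).add
    (hright.const_smul Complex.I)).sub (hleft.const_smul Complex.I)
  simp only [hrect, smul_zero, add_zero, sub_zero] at hsum
  exact sub_eq_zero.1 (tendsto_nhds_unique hsum tendsto_const_nhds)

theorem exp_ofReal_add_mul_I (x y : ℝ) :
    Complex.exp (x + y * Complex.I) = Real.exp x * Complex.exp (y * Complex.I) := by
  rw [Complex.exp_add, Complex.ofReal_exp]

-- In logarithmic coordinates the rotation becomes a vertical translation.
theorem exp_smul_integral_ray_eq_of_norm_le {F : ℂ → E} {B : ℝ → ℝ}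
    (hF : ∀ r > 0, ∀ y ∈ Set.uIcc a b,
      DifferentiableAt ℂ F ((r : ℝ) * Complex.exp (y * Complex.I)))
    (hB : IntegrableOn B (Set.Ioi 0)) (hzero : Tendsto (fun r => r * B r) (𝓝[>] 0) (𝓝 0))
    (htop : Tendsto (fun r => r * B r) atTop (𝓝 0))
    (hle : ∀ r > 0, ∀ y ∈ Set.uIcc a b, ‖F ((r : ℝ) * Complex.exp (y * Complex.I))‖ ≤ B r) :
    Complex.exp (a * Complex.I) • ∫ r : ℝ in Set.Ioi 0, F (r * Complex.exp (a * Complex.I)) =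
      Complex.exp (b * Complex.I) • ∫ r : ℝ in Set.Ioi 0, F (r * Complex.exp (b * Complex.I)) := by
  let G : ℂ → E := fun w => Complex.exp w • F (Complex.exp w)
  have hG : ∀ x y : ℝ, G (x + y * Complex.I) = Complex.exp (y * Complex.I) •
      (Real.exp x • F (Real.exp x * Complex.exp (y * Complex.I))) := fun x y => by
    simp only [G, exp_ofReal_add_mul_I]
    rw [mul_comm, mul_smul, Complex.coe_smul, mul_comm]
  have hray : ∀ y : ℝ, ∫ x : ℝ, G (x + y * Complex.I) = Complex.exp (y * Complex.I) •
      ∫ r : ℝ in Set.Ioi 0, F (r * Complex.exp (y * Complex.I)) := fun y => by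
    simp only [hG]
    rw [integral_smul, integral_Ioi_eq_integral_exp_smul]
  rw [← hray, ← hray]
  refine integral_add_mul_I_eq_of_norm_le (B := fun x => Real.exp x * B (Real.exp x))
    (fun w hw => ?_) (integrableOn_Ioi_iff_integrable_exp_smul.1 hB)
    (hzero.comp Real.tendsto_exp_atBot_nhdsGT) (htop.comp Real.tendsto_exp_atTop)
    fun x y hy => ?_
  · have hFw : DifferentiableAt ℂ F (Complex.exp w) := by
      rw [← Complex.re_add_im w, exp_ofReal_add_mul_I]
      exact hF _ (Real.exp_pos _) _ hw.2
    exact (Complex.differentiableAt_exp.smul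
      (hFw.comp w Complex.differentiableAt_exp)).differentiableWithinAt
  · rw [hG, norm_smul, norm_smul, Complex.norm_exp_ofReal_mul_I, one_mul, Real.norm_eq_abs,
      Real.abs_exp]
    gcongr
    exact hle _ (Real.exp_pos x) y hy

theorem tendsto_rpow_mul_exp_neg_mul_rpow_atTop (p : ℝ) {β κ : ℝ} (hβ : 0 < β) (hκ : 0 < κ) :
    Tendsto (fun r : ℝ => r ^ p * Real.exp (-κ * r ^ β)) atTop (𝓝 0) := by
  refine ((tendsto_rpow_mul_exp_neg_mul_atTop_nhds_zero (p / β) κ hκ).comp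
    (tendsto_rpow_atTop hβ)).congr' ?_
  filter_upwards [eventually_ge_atTop 0] with r hr
  rw [Function.comp_apply, ← Real.rpow_mul hr, mul_div_cancel₀ _ hβ.ne']

theorem tendsto_rpow_mul_exp_neg_mul_rpow_zero {p β : ℝ} (hp : 0 < p) (hβ : 0 < β) (κ : ℝ) :
    Tendsto (fun r : ℝ => r ^ p * Real.exp (-κ * r ^ β)) (𝓝[>] 0) (𝓝 0) := by
  have hcont : ContinuousAt (fun r : ℝ => r ^ p * Real.exp (-κ * r ^ β)) 0 :=
    (Real.continuousAt_rpow_const 0 p (.inr hp.le)).mul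
      ((Real.continuousAt_rpow_const 0 β (.inr hβ.le)).const_mul _).rexp
  have h := hcont.tendsto.mono_left (nhdsWithin_le_nhds (s := Set.Ioi 0))
  simpa only [Real.zero_rpow hp.ne', zero_mul] using h

theorem exp_smul_integral_ray_eq_of_norm_le_rpow_mul_exp {F : ℂ → E} {p β κ : ℝ} (hp : 0 < p)
    (hβ : 0 < β) (hκ : 0 < κ)
    (hF : ∀ r > 0, ∀ y ∈ Set.uIcc a b,
      DifferentiableAt ℂ F ((r : ℝ) * Complex.exp (y * Complex.I)))
    (hle : ∀ r > 0, ∀ y ∈ Set.uIcc a b,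
      ‖F ((r : ℝ) * Complex.exp (y * Complex.I))‖ ≤ r ^ (p - 1) * Real.exp (-κ * r ^ β)) :
    Complex.exp (a * Complex.I) • ∫ r : ℝ in Set.Ioi 0, F (r * Complex.exp (a * Complex.I)) =
      Complex.exp (b * Complex.I) • ∫ r : ℝ in Set.Ioi 0, F (r * Complex.exp (b * Complex.I)) := by
  have hmul : ∀ r > (0 : ℝ), r ^ p * Real.exp (-κ * r ^ β) =
      r * (r ^ (p - 1) * Real.exp (-κ * r ^ β)) := fun r hr => by
    rw [Real.rpow_sub_one hr.ne']
    field_simp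
  refine exp_smul_integral_ray_eq_of_norm_le hF
    (integrableOn_rpow_mul_exp_neg_mul_rpow (by linarith) hβ hκ) ?_ ?_ hle
  · refine (tendsto_rpow_mul_exp_neg_mul_rpow_zero hp hβ κ).congr' ?_
    filter_upwards [self_mem_nhdsWithin] with r hr using hmul r hr
  · refine (tendsto_rpow_mul_exp_neg_mul_rpow_atTop p hβ hκ).congr' ?_
    filter_upwards [eventually_gt_atTop 0] with r hr using hmul r hr

end Rotation

theorem arg_ofReal_mul_exp_mul_I {r y : ℝ} (hr : 0 < r) (hy : y ∈ Set.Ioc (-Real.pi) Real.pi) :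
    (r * Complex.exp (y * Complex.I)).arg = y := by
  rw [Complex.exp_mul_I, Complex.arg_mul_cos_add_sin_mul_I hr hy]

theorem ofReal_mul_exp_mul_I_mem_slitPlane {r y : ℝ} (hr : 0 < r)
    (hy : y ∈ Set.Ioo (-Real.pi) Real.pi) :
    r * Complex.exp (y * Complex.I) ∈ Complex.slitPlane := by
  rw [Complex.mem_slitPlane_iff_arg, arg_ofReal_mul_exp_mul_I hr (Set.Ioo_subset_Ioc_self hy)]
  exact ⟨hy.2.ne, mul_ne_zero (Complex.ofReal_ne_zero.2 hr.ne') (Complex.exp_ne_zero _)⟩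

theorem ofReal_mul_exp_mul_I_cpow {r y : ℝ} (hr : 0 < r) (hy : y ∈ Set.Ioc (-Real.pi) Real.pi)
    (p : ℝ) : (r * Complex.exp (y * Complex.I)) ^ (p : ℂ) =
      (r ^ p : ℝ) * Complex.exp ((p * y : ℝ) * Complex.I) := by
  have hne : r * Complex.exp (y * Complex.I) ≠ 0 :=
    mul_ne_zero (Complex.ofReal_ne_zero.2 hr.ne') (Complex.exp_ne_zero _)
  rw [Complex.cpow_def_of_ne_zero hne, Complex.log, arg_ofReal_mul_exp_mul_I hr hy, norm_mul,
    Complex.norm_exp_ofReal_mul_I, mul_one, Complex.norm_of_nonneg hr.le, Real.rpow_def_of_pos hr,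
    Complex.ofReal_exp, ← Complex.exp_add]
  push_cast
  ring_nf

theorem norm_exp_I_mul_ofReal_mul_exp_mul_I (r y : ℝ) :
    ‖Complex.exp (Complex.I * (r * Complex.exp (y * Complex.I)))‖ =
      Real.exp (-(Real.sin y * r)) := by
  rw [Complex.norm_exp, Complex.I_mul_re, Complex.im_ofReal_mul, Complex.exp_ofReal_mul_I_im,
    mul_comm]

theorem sin_pi_div_four_pos : 0 < Real.sin (Real.pi / 4) := by
  rw [Real.sin_pi_div_four]
  positivity

theorem norm_ray_cpow_mul_exp_I {r y p : ℝ} (hr : 0 < r) (hy : y ∈ Set.Ioc (-Real.pi) Real.pi) :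
    ‖(r * Complex.exp (y * Complex.I)) ^ (p : ℂ) *
        Complex.exp (Complex.I * (r * Complex.exp (y * Complex.I)))‖ =
      r ^ p * Real.exp (-(Real.sin y * r)) := by
  rw [norm_mul, norm_exp_I_mul_ofReal_mul_exp_mul_I, ofReal_mul_exp_mul_I_cpow hr hy, norm_mul,
    Complex.norm_exp_ofReal_mul_I, mul_one, Complex.norm_of_nonneg (by positivity)]

theorem integral_ray_cpow_mul_exp_I {p : ℝ} (hp : 0 < p) :
    Complex.exp ((Real.pi / 4 : ℝ) * Complex.I) * ∫ r : ℝ in Set.Ioi 0,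
        (r * Complex.exp ((Real.pi / 4 : ℝ) * Complex.I)) ^ ((p - 1 : ℝ) : ℂ) *
          Complex.exp (Complex.I * (r * Complex.exp ((Real.pi / 4 : ℝ) * Complex.I))) =
      Complex.exp ((p * (Real.pi / 2) : ℝ) * Complex.I) * Real.Gamma p := by
  have hpi := Real.pi_pos
  have hsector : ∀ y ∈ Set.uIcc (Real.pi / 4) (Real.pi / 2), Real.pi / 4 ≤ y ∧ y ≤ Real.pi / 2 :=
    fun y hy => by rwa [Set.uIcc_of_le (by linarith)] at hy
  have hrot := exp_smul_integral_ray_eq_of_norm_le_rpow_mul_exp (a := Real.pi / 4)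
    (b := Real.pi / 2) (F := fun z => z ^ ((p - 1 : ℝ) : ℂ) * Complex.exp (Complex.I * z))
    hp one_pos sin_pi_div_four_pos ?_ ?_
  · rw [smul_eq_mul, smul_eq_mul] at hrot
    have hpos : ∀ r ∈ Set.Ioi (0 : ℝ),
        (r * Complex.exp ((Real.pi / 2 : ℝ) * Complex.I)) ^ ((p - 1 : ℝ) : ℂ) *
          Complex.exp (Complex.I * (r * Complex.exp ((Real.pi / 2 : ℝ) * Complex.I))) =
        Complex.exp (((p - 1) * (Real.pi / 2) : ℝ) * Complex.I) *
          ((Real.exp (-r) * r ^ (p - 1) : ℝ) : ℂ) := fun r hr => by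
      rw [ofReal_mul_exp_mul_I_cpow hr ⟨by linarith, by linarith⟩]
      push_cast
      rw [Complex.exp_pi_div_two_mul_I, mul_left_comm, Complex.I_mul_I]
      ring_nf
    rw [hrot, setIntegral_congr_fun measurableSet_Ioi hpos, integral_const_mul,
      integral_complex_ofReal, ← Real.Gamma_eq_integral hp, ← mul_assoc, ← Complex.exp_add]
    push_cast
    ring_nf
  · intro r hr y hy
    obtain ⟨h1, h2⟩ := hsector y hy
    have hmem := ofReal_mul_exp_mul_I_mem_slitPlane hr (y := y) ⟨by linarith, by linarith⟩
    exact (differentiableAt_id.cpow_const hmem).mul (by fun_prop)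
  · intro r hr y hy
    obtain ⟨h1, h2⟩ := hsector y hy
    have hr : 0 < r := hr
    rw [norm_ray_cpow_mul_exp_I hr ⟨by linarith, by linarith⟩, Real.rpow_one, ← neg_mul]
    gcongr
    exact Real.sin_le_sin_of_le_of_le_pi_div_two (by linarith) h2 h1

theorem integrableOn_ray_cpow_mul_exp_I {p : ℝ} (hp : 0 < p) :
    IntegrableOn (fun r : ℝ =>
      (r * Complex.exp ((Real.pi / 4 : ℝ) * Complex.I)) ^ ((p - 1 : ℝ) : ℂ) *
        Complex.exp (Complex.I * (r * Complex.exp ((Real.pi / 4 : ℝ) * Complex.I))))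
      (Set.Ioi 0) := by
  have hpi := Real.pi_pos
  refine (integrableOn_rpow_mul_exp_neg_mul_rpow (by linarith : -1 < p - 1) one_pos
    sin_pi_div_four_pos).mono' (by fun_prop : Measurable _).aestronglyMeasurable ?_
  filter_upwards [ae_restrict_mem measurableSet_Ioi] with r hr
  rw [norm_ray_cpow_mul_exp_I hr ⟨by linarith, by linarith⟩, Real.rpow_one, ← neg_mul]

/-! ### The tail of the symmetric stable density -/

theorem norm_exp_sub_one_le_of_re_nonpos {z : ℂ} (hz : z.re ≤ 0) :
    ‖Complex.exp z - 1‖ ≤ ‖z‖ := by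
  have h := (convex_halfSpace_re_le (0 : ℝ)).norm_image_sub_le_of_norm_hasDerivWithin_le
    (f := Complex.exp) (f' := Complex.exp) (C := 1) (x := 0) (y := z)
    (fun w _ => (Complex.hasDerivAt_exp w).hasDerivWithinAt)
    (fun w hw => by rw [Complex.norm_exp]; exact Real.exp_le_one_iff.2 hw) (by simp) hz
  simpa using h

theorem slope_exp_neg_mul (q : ℂ) (b : ℝ) :
    slope (fun b : ℝ => Complex.exp (-(b * q))) 0 b =
      ((b : ℂ))⁻¹ * (Complex.exp (-(b * q)) - 1) := by
  simp [slope_def_module]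

theorem norm_slope_exp_neg_mul_le {q : ℂ} (hq : 0 ≤ q.re) {b : ℝ} (hb : 0 < b) :
    ‖slope (fun b : ℝ => Complex.exp (-(b * q))) 0 b‖ ≤ ‖q‖ := by
  have hre : (-((b : ℂ) * q)).re ≤ 0 := by
    rw [Complex.neg_re, Complex.re_ofReal_mul, neg_nonpos]
    exact mul_nonneg hb.le hq
  have h := norm_exp_sub_one_le_of_re_nonpos hre
  rw [norm_neg, norm_mul, Complex.norm_of_nonneg hb.le] at h
  rw [slope_exp_neg_mul, norm_mul, norm_inv, Complex.norm_of_nonneg hb.le]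
  exact (inv_mul_le_iff₀ hb).2 h

theorem tendsto_slope_exp_neg_mul (q : ℂ) :
    Tendsto (slope (fun b : ℝ => Complex.exp (-(b * q))) 0) (𝓝[>] 0) (𝓝 (-q)) := by
  have hderiv : HasDerivAt (fun b : ℝ => Complex.exp (-(b * q))) (-q) 0 := by
    simpa using ((Complex.ofRealCLM.hasDerivAt (x := (0 : ℝ))).mul_const q).neg.cexp
  exact (hasDerivWithinAt_iff_tendsto_slope' Set.self_notMem_Ioi).1 hderiv.hasDerivWithinAt

theorem hasDerivWithinAt_integral_exp_neg_mul {X : Type*} [MeasurableSpace X] {μ : Measure X}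
    {q g : X → ℂ} (hq : AEStronglyMeasurable q μ) (hre : ∀ᵐ x ∂μ, 0 ≤ (q x).re)
    (hg : Integrable g μ) (hqg : Integrable (fun x => q x * g x) μ) :
    HasDerivWithinAt (fun b : ℝ => ∫ x, Complex.exp (-(b * q x)) * g x ∂μ)
      (-∫ x, q x * g x ∂μ) (Set.Ioi 0) 0 := by
  have hexp : ∀ b : ℝ, AEStronglyMeasurable (fun x => Complex.exp (-(b * q x))) μ := fun b =>
    Complex.continuous_exp.comp_aestronglyMeasurable (hq.const_mul _).neg
  have hint : ∀ b : ℝ, 0 ≤ b → Integrable (fun x => Complex.exp (-(b * q x)) * g x) μ :=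
    fun b hb => by
      refine hg.bdd_mul (hexp b) (c := 1) ?_
      filter_upwards [hre] with x hx
      rw [Complex.norm_exp, Real.exp_le_one_iff, Complex.neg_re, Complex.re_ofReal_mul]
      exact neg_nonpos.2 (mul_nonneg hb hx)
  have hslope : ∀ b : ℝ, 0 < b →
      slope (fun b : ℝ => ∫ x, Complex.exp (-(b * q x)) * g x ∂μ) 0 b =
        ∫ x, slope (fun b : ℝ => Complex.exp (-(b * q x))) 0 b * g x ∂μ := fun b hb => by
    rw [slope_def_module, ← integral_sub (hint b hb.le) (hint 0 le_rfl), ← integral_smul]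
    refine integral_congr_ae (.of_forall fun x => ?_)
    simp only [slope_def_module, ← sub_mul, smul_mul_assoc]
  rw [hasDerivWithinAt_iff_tendsto_slope' Set.self_notMem_Ioi, ← integral_neg]
  refine Tendsto.congr' (f₁ := fun b =>
    ∫ x, slope (fun b : ℝ => Complex.exp (-(b * q x))) 0 b * g x ∂μ) ?_ ?_
  · filter_upwards [self_mem_nhdsWithin] with b hb using (hslope b hb).symm
  refine tendsto_integral_filter_of_dominated_convergence (fun x => ‖q x * g x‖) ?_ ?_ hqg.norm ?_
  · refine .of_forall fun b => ?_
    simp only [slope_exp_neg_mul]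
    exact (((hexp b).sub aestronglyMeasurable_const).const_mul _).mul hg.aestronglyMeasurable
  · filter_upwards [self_mem_nhdsWithin] with b hb
    filter_upwards [hre] with x hx
    rw [norm_mul, norm_mul]
    gcongr
    exact norm_slope_exp_neg_mul_le hx hb
  · refine .of_forall fun x => ?_
    simpa only [neg_mul] using (tendsto_slope_exp_neg_mul (q x)).mul_const (g x)

/-- The oscillatory integral `∫ z > 0, exp (-b z ^ α + i z)`. Up to a rescaling of `z`, its real
part is the symmetric stable density of index `α`. -/
def oscIntegral (α b : ℝ) : ℂ :=
  ∫ z : ℝ in Set.Ioi 0, Complex.exp (-(b * (z ^ α : ℝ))) * Complex.exp (Complex.I * z)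

theorem rpow_mul_cos_le_re_ray_cpow {α y r : ℝ} (hα : 0 < α) (hα2 : α < 2) (hr : 0 < r) (hy : 0 ≤ y)
    (hy4 : y ≤ Real.pi / 4) :
    r ^ α * Real.cos (α * (Real.pi / 4)) ≤
      ((r * Complex.exp (y * Complex.I)) ^ (α : ℂ)).re := by
  have hpi := Real.pi_pos
  rw [ofReal_mul_exp_mul_I_cpow hr ⟨by linarith, by linarith⟩, Complex.re_ofReal_mul,
    Complex.exp_ofReal_mul_I_re]
  gcongr
  exact Real.cos_le_cos_of_nonneg_of_le_pi (by positivity) (by nlinarith) (by gcongr)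

theorem cos_mul_pi_div_four_pos {α : ℝ} (hα : 0 < α) (hα2 : α < 2) :
    0 < Real.cos (α * (Real.pi / 4)) :=
  Real.cos_pos_of_mem_Ioo ⟨by nlinarith [Real.pi_pos], by nlinarith [Real.pi_pos]⟩

theorem oscIntegral_eq_integral_ray {α b : ℝ} (hα : 0 < α) (hα2 : α < 2) (hb : 0 < b) :
    oscIntegral α b = Complex.exp ((Real.pi / 4 : ℝ) * Complex.I) * ∫ r : ℝ in Set.Ioi 0,
      Complex.exp (-(b * (r * Complex.exp ((Real.pi / 4 : ℝ) * Complex.I)) ^ (α : ℂ))) *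
        Complex.exp (Complex.I * (r * Complex.exp ((Real.pi / 4 : ℝ) * Complex.I))) := by
  have hpi := Real.pi_pos
  have hsector : ∀ y ∈ Set.uIcc 0 (Real.pi / 4), 0 ≤ y ∧ y ≤ Real.pi / 4 :=
    fun y hy => by rwa [Set.uIcc_of_le (by linarith)] at hy
  have hrot := exp_smul_integral_ray_eq_of_norm_le_rpow_mul_exp (a := 0) (b := Real.pi / 4)
    (F := fun z => Complex.exp (-(b * z ^ (α : ℂ))) * Complex.exp (Complex.I * z))
    one_pos hα (mul_pos hb (cos_mul_pi_div_four_pos hα hα2)) ?_ ?_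
  · rw [smul_eq_mul, smul_eq_mul, Complex.ofReal_zero, zero_mul, Complex.exp_zero, one_mul] at hrot
    rw [← hrot, oscIntegral]
    refine setIntegral_congr_fun measurableSet_Ioi fun z hz => ?_
    simp only [mul_one, Complex.ofReal_cpow (le_of_lt hz)]
  · intro r hr y hy
    obtain ⟨h1, h2⟩ := hsector y hy
    have hmem := ofReal_mul_exp_mul_I_mem_slitPlane hr (y := y) ⟨by linarith, by linarith⟩
    exact ((differentiableAt_id.cpow_const hmem).const_mul _).neg.cexp.mul (by fun_prop)
  · intro r hr y hy
    obtain ⟨h1, h2⟩ := hsector y hy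
    have hr : 0 < r := hr
    have hre := rpow_mul_cos_le_re_ray_cpow hα hα2 hr h1 h2
    have hsin : 0 ≤ Real.sin y * r :=
      mul_nonneg (Real.sin_nonneg_of_nonneg_of_le_pi h1 (by linarith)) hr.le
    rw [norm_mul, norm_exp_I_mul_ofReal_mul_exp_mul_I, Complex.norm_exp, ← Real.exp_add, sub_self,
      Real.rpow_zero, one_mul, Real.exp_le_exp, Complex.neg_re, Complex.re_ofReal_mul]
    nlinarith

theorem tendsto_oscIntegral_sub_I_div {α : ℝ} (hα : 0 < α) (hα2 : α < 2) :
    Tendsto (fun b : ℝ => (oscIntegral α b - Complex.I) / b) (𝓝[>] 0)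
      (𝓝 (-(Complex.exp (((α + 1) * (Real.pi / 2) : ℝ) * Complex.I) * Real.Gamma (α + 1)))) := by
  let ω : ℂ := Complex.exp ((Real.pi / 4 : ℝ) * Complex.I)
  let q : ℝ → ℂ := fun r => (r * ω) ^ (α : ℂ)
  let g : ℝ → ℂ := fun r => Complex.exp (Complex.I * (r * ω))
  let J : ℝ → ℂ := fun b => ω * ∫ r in Set.Ioi 0, Complex.exp (-(b * q r)) * g r
  have hJ : ∀ b > 0, oscIntegral α b = J b := fun b hb => oscIntegral_eq_integral_ray hα hα2 hb
  have hJ0 : J 0 = Complex.I := by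
    simpa [J, g, ω, Complex.exp_pi_div_two_mul_I] using integral_ray_cpow_mul_exp_I one_pos
  have hq : AEStronglyMeasurable q (volume.restrict (Set.Ioi 0)) :=
    (by fun_prop : Measurable q).aestronglyMeasurable
  have hre : ∀ᵐ r ∂volume.restrict (Set.Ioi 0), 0 ≤ (q r).re := by
    filter_upwards [ae_restrict_mem measurableSet_Ioi] with r hr
    exact (mul_nonneg (Real.rpow_nonneg (le_of_lt hr) _) (cos_mul_pi_div_four_pos hα hα2).le).trans
      (rpow_mul_cos_le_re_ray_cpow hα hα2 hr (by positivity) le_rfl)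
  have hg : IntegrableOn g (Set.Ioi 0) := by
    simpa [g, ω] using integrableOn_ray_cpow_mul_exp_I one_pos
  have hα1 : 0 < α + 1 := by linarith
  have hqg : IntegrableOn (fun r => q r * g r) (Set.Ioi 0) := by
    simpa only [add_sub_cancel_right] using integrableOn_ray_cpow_mul_exp_I hα1
  have hqg_integral := integral_ray_cpow_mul_exp_I hα1
  rw [add_sub_cancel_right] at hqg_integral
  have hderiv : HasDerivWithinAt J _ (Set.Ioi 0) 0 :=
    (hasDerivWithinAt_integral_exp_neg_mul hq hre hg hqg).const_mul ω
  rw [hasDerivWithinAt_iff_tendsto_slope' Set.self_notMem_Ioi, mul_neg, hqg_integral] at hderiv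
  refine hderiv.congr' ?_
  filter_upwards [self_mem_nhdsWithin] with b hb
  rw [slope_def_module, hJ0, ← hJ b hb, sub_zero, Complex.real_smul, Complex.ofReal_inv,
    inv_mul_eq_div]

theorem tendsto_re_oscIntegral_div {α : ℝ} (hα : 0 < α) (hα2 : α < 2) :
    Tendsto (fun b => (oscIntegral α b).re / b) (𝓝[>] 0)
      (𝓝 (Real.Gamma (α + 1) * Real.sin (Real.pi * α / 2))) := by
  have h := (Complex.continuous_re.tendsto _).comp (tendsto_oscIntegral_sub_I_div hα hα2)
  rw [Complex.neg_re, Complex.re_mul_ofReal, Complex.exp_ofReal_mul_I_re,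
    (by ring : (α + 1) * (Real.pi / 2) = Real.pi * α / 2 + Real.pi / 2),
    Real.cos_add_pi_div_two, neg_mul, neg_neg, mul_comm] at h
  refine h.congr fun b => ?_
  simp only [Function.comp_apply, Complex.div_ofReal_re, Complex.sub_re, Complex.I_re, sub_zero]

theorem re_exp_neg_mul_exp_neg_I_mul (α γ ξ z : ℝ) :
    ((Real.exp (-|γ * z| ^ α) : ℂ) * Complex.exp (-(Complex.I * ξ * z))).re =
      Real.exp (-|γ * abs z| ^ α) * Real.cos (ξ * |z|) := by
  rw [Complex.re_ofReal_mul, Complex.exp_re]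
  simp [abs_mul, ← Real.cos_abs (ξ * z), ← Real.cos_abs (ξ * |z|)]

theorem stableDensity_neg (ξ α γ : ℝ) :
    stableDensity (-ξ) α 0 γ 0 = stableDensity ξ α 0 γ 0 := by
  rw [← Complex.ofReal_inj, stableDensity_symm_eq_integral, stableDensity_symm_eq_integral,
    ← integral_neg_eq_self]
  simp

theorem stableDensity_eq_integral_cos {α γ : ℝ} (hα : 0 < α) (hγ : 0 < γ) (ξ : ℝ) :
    stableDensity ξ α 0 γ 0 = 1 / Real.pi *
      ∫ z in Set.Ioi 0, Real.exp (-|γ * z| ^ α) * Real.cos (ξ * z) := by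
  have hint : Integrable fun z : ℝ =>
      (Real.exp (-|γ * z| ^ α) : ℂ) * Complex.exp (-(Complex.I * ξ * z)) := by
    refine (integrable_exp_neg_mul_abs_rpow hα (Real.rpow_pos_of_pos hγ α)).mono'
      (by fun_prop : Measurable _).aestronglyMeasurable (.of_forall fun z => ?_)
    rw [norm_mul, Complex.norm_of_nonneg (Real.exp_pos _).le, exp_neg_abs_mul_rpow_eq α hγ.le]
    simp [Complex.norm_exp]
  have hpi : (1 / (2 * Real.pi) : ℂ) = ((1 / (2 * Real.pi) : ℝ) : ℂ) := by push_cast; rfl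
  rw [← Complex.ofReal_re (stableDensity ξ α 0 γ 0), stableDensity_symm_eq_integral, hpi,
    Complex.re_ofReal_mul, ← Complex.reCLM_apply, ← ContinuousLinearMap.integral_comp_comm _ hint]
  simp only [Complex.reCLM_apply, re_exp_neg_mul_exp_neg_I_mul]
  rw [integral_comp_abs (f := fun z => Real.exp (-|γ * z| ^ α) * Real.cos (ξ * z)), ← mul_assoc,
    show 1 / (2 * Real.pi) * 2 = 1 / Real.pi by field_simp]

theorem integrableOn_exp_neg_mul_rpow_mul_exp_I {α b : ℝ} (hα : 0 < α) (hb : 0 < b) :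
    IntegrableOn (fun z : ℝ => Complex.exp (-(b * (z ^ α : ℝ))) * Complex.exp (Complex.I * z))
      (Set.Ioi 0) := by
  have hdom := integrableOn_rpow_mul_exp_neg_mul_rpow (s := 0) (by norm_num) hα hb
  refine hdom.mono' (by fun_prop : Measurable _).aestronglyMeasurable (.of_forall fun z => ?_)
  simp [Complex.norm_exp]

theorem re_oscIntegral {α b : ℝ} (hα : 0 < α) (hb : 0 < b) :
    (oscIntegral α b).re = ∫ z in Set.Ioi 0, Real.exp (-(b * z ^ α)) * Real.cos z := by
  rw [oscIntegral, ← Complex.reCLM_apply,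
    ← ContinuousLinearMap.integral_comp_comm _ (integrableOn_exp_neg_mul_rpow_mul_exp_I hα hb)]
  congr with z
  rw [Complex.reCLM_apply, mul_comm Complex.I, ← Complex.ofReal_mul, ← Complex.ofReal_neg,
    ← Complex.ofReal_exp, Complex.re_ofReal_mul, Complex.exp_ofReal_mul_I_re]

theorem stableDensity_eq_re_oscIntegral {α γ ξ : ℝ} (hα : 0 < α) (hγ : 0 < γ) (hξ : 0 < ξ) :
    stableDensity ξ α 0 γ 0 =
      1 / Real.pi * (ξ⁻¹ * (oscIntegral α (γ ^ α * ξ ^ (-α))).re) := by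
  have hscale : ∀ z ∈ Set.Ioi (0 : ℝ), Real.exp (-|γ * z| ^ α) * Real.cos (ξ * z) =
      Real.exp (-(γ ^ α * ξ ^ (-α) * (ξ * z) ^ α)) * Real.cos (ξ * z) := fun z hz => by
    have hz : 0 < z := hz
    rw [exp_neg_abs_mul_rpow_eq α hγ.le, abs_of_pos hz, mul_assoc, Real.mul_rpow hξ.le hz.le,
      Real.rpow_neg hξ.le, inv_mul_cancel_left₀ (Real.rpow_pos_of_pos hξ α).ne']
  have hcomp := integral_comp_mul_left_Ioi
    (fun z => Real.exp (-(γ ^ α * ξ ^ (-α) * z ^ α)) * Real.cos z) 0 hξ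
  rw [mul_zero, smul_eq_mul] at hcomp
  rw [stableDensity_eq_integral_cos hα hγ, setIntegral_congr_fun measurableSet_Ioi hscale, hcomp,
    re_oscIntegral hα (by positivity)]

theorem tendsto_stableDensity_mul_rpow_atTop {α γ : ℝ} (hα : 0 < α) (hα2 : α < 2) (hγ : 0 < γ) :
    Tendsto (fun ξ => stableDensity ξ α 0 γ 0 * ξ ^ (α + 1)) atTop
      (𝓝 (γ ^ α / Real.pi * (Real.Gamma (α + 1) * Real.sin (Real.pi * α / 2)))) := by
  have hγα : 0 < γ ^ α := Real.rpow_pos_of_pos hγ α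
  have hb : Tendsto (fun ξ : ℝ => γ ^ α * ξ ^ (-α)) atTop (𝓝[>] 0) := by
    refine tendsto_nhdsWithin_iff.2 ⟨?_, ?_⟩
    · simpa using (tendsto_rpow_neg_atTop hα).const_mul (γ ^ α)
    · filter_upwards [eventually_gt_atTop 0] with ξ hξ
      exact mul_pos hγα (Real.rpow_pos_of_pos hξ _)
  refine (((tendsto_re_oscIntegral_div hα hα2).comp hb).const_mul (γ ^ α / Real.pi)).congr' ?_
  filter_upwards [eventually_gt_atTop 0] with ξ hξ
  have : 0 < ξ ^ α := Real.rpow_pos_of_pos hξ α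
  rw [Function.comp_apply, stableDensity_eq_re_oscIntegral hα hγ hξ, Real.rpow_add_one hξ.ne',
    Real.rpow_neg hξ.le]
  field_simp

theorem tendsto_stableDensity_mul_rpow_cobounded {α γ : ℝ} (hα : 0 < α) (hα2 : α < 2)
    (hγ : 0 < γ) :
    Tendsto (fun ξ => stableDensity ξ α 0 γ 0 * |ξ| ^ (α + 1)) (Bornology.cobounded ℝ)
      (𝓝 (γ ^ α / Real.pi * (Real.Gamma (α + 1) * Real.sin (Real.pi * α / 2)))) := by
  refine ((tendsto_stableDensity_mul_rpow_atTop hα hα2 hγ).comp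
    tendsto_norm_cobounded_atTop).congr fun ξ => ?_
  have habs : stableDensity |ξ| α 0 γ 0 = stableDensity ξ α 0 γ 0 := by
    rcases abs_choice ξ with h | h <;> simp only [h, stableDensity_neg]
  rw [Function.comp_apply, Real.norm_eq_abs, habs]

/-! ### The parameters of the limit law -/

/-- The constant `-π / (Γ(s) cos (π s / 2))`, which is `γ ^ (s - 1)` for the limit law in the range
`1 < s < 3`. -/
def stableConst (s : ℝ) : ℝ := -(Real.pi / (Real.Gamma s * Real.cos (Real.pi * s / 2)))

theorem stableConst_eq (s : ℝ) :
    stableConst s = Real.pi / (Real.Gamma s * Real.sin (Real.pi * (s - 1) / 2)) := by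
  rw [(by ring : Real.pi * (s - 1) / 2 = Real.pi * s / 2 - Real.pi / 2),
    Real.sin_sub_pi_div_two, mul_neg, div_neg, stableConst]

theorem sin_pi_mul_div_two_pos {α : ℝ} (hα : 0 < α) (hα2 : α < 2) :
    0 < Real.sin (Real.pi * α / 2) :=
  Real.sin_pos_of_pos_of_lt_pi (by positivity) (by nlinarith [Real.pi_pos])

theorem stableConst_pos {s : ℝ} (hs : 1 < s) (hs3 : s < 3) : 0 < stableConst s := by
  have hsin := sin_pi_mul_div_two_pos (by linarith : 0 < s - 1) (by linarith)
  have : 0 < Real.Gamma s := Real.Gamma_pos_of_pos (by linarith)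
  rw [stableConst_eq]
  positivity

theorem stableConst_rpow_rpow {s : ℝ} (hs : 1 < s) (hs3 : s < 3) :
    (stableConst s ^ (1 / (s - 1))) ^ (s - 1) = stableConst s := by
  rw [one_div, Real.rpow_inv_rpow (stableConst_pos hs hs3).le (by linarith)]

theorem hasStableAsymptotics_of_lt_three {s : ℝ} (hs : 1 < s) (hs3 : s < 3) {u : ℝ → EllTwo}
    (hu : IsSolution (mellinLaplacian s) e0 u) :
    HasStableAsymptotics u (s - 1) (stableConst s ^ (1 / (s - 1))) := by
  refine hasStableAsymptotics_of_tendsto_mellinSymbol hs (by linarith)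
    (Real.rpow_pos_of_pos (stableConst_pos hs hs3) _) ?_ hu
  rw [stableConst_rpow_rpow hs hs3, stableConst, ← integral_one_sub_cos_mul_rpow hs hs3]
  exact tendsto_mellinSymbol_div_rpow hs hs3

theorem tendsto_stableDensity_div_rpow {s : ℝ} (hs : 1 < s) (hs3 : s < 3) :
    Tendsto (fun ξ => stableDensity ξ (s - 1) 0 (stableConst s ^ (1 / (s - 1))) 0 / (1 / |ξ| ^ s))
      (Bornology.cobounded ℝ) (𝓝 1) := by
  have h := tendsto_stableDensity_mul_rpow_cobounded (by linarith : 0 < s - 1) (by linarith)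
    (Real.rpow_pos_of_pos (stableConst_pos hs hs3) (1 / (s - 1)))
  rw [sub_add_cancel, stableConst_rpow_rpow hs hs3] at h
  have hone : stableConst s / Real.pi *
      (Real.Gamma s * Real.sin (Real.pi * (s - 1) / 2)) = 1 := by
    have hsin := sin_pi_mul_div_two_pos (by linarith : 0 < s - 1) (by linarith)
    have : 0 < Real.Gamma s := Real.Gamma_pos_of_pos (by linarith)
    rw [stableConst_eq]
    field_simp
  rw [hone] at h
  simpa only [div_div_eq_mul_div, div_one] using h

theorem hasStableAsymptotics_of_three_lt {s : ℝ} (hs3 : 3 < s) {u : ℝ → EllTwo}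
    (hu : IsSolution (mellinLaplacian s) e0 u) :
    HasStableAsymptotics u 2 (Real.sqrt (riemannZeta ((s : ℂ) - 2)).re) := by
  have hζ : 0 < (riemannZeta ((s : ℂ) - 2)).re := by
    simpa using riemannZeta_re_pos_of_one_lt (by linarith : 1 < s - 2)
  refine hasStableAsymptotics_of_tendsto_mellinSymbol (by linarith) two_pos (Real.sqrt_pos.2 hζ)
    ?_ hu
  rw [Real.rpow_two, Real.sq_sqrt hζ.le]
  exact tendsto_mellinSymbol_div_sq hs3

end PathLaplacian

end

theorem mainTheorem7 (s : ℝ) (hs : 1 < s) (u : ℝ → PathLaplacian.EllTwo)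
    (hu : PathLaplacian.IsSolution (PathLaplacian.mellinLaplacian s) PathLaplacian.e0 u) :
    (s < 3 → ∀ α γ : ℝ, α = s - 1 →
      γ = (-(Real.pi / (Real.Gamma s * Real.cos (Real.pi * s / 2)))) ^ (1 / (s - 1)) →
      PathLaplacian.HasStableAsymptotics u α γ ∧
      Tendsto (fun ξ : ℝ => PathLaplacian.stableDensity ξ α 0 γ 0 / (1 / |ξ| ^ s))
        atTop (𝓝 1) ∧
      Tendsto (fun ξ : ℝ => PathLaplacian.stableDensity ξ α 0 γ 0 / (1 / |ξ| ^ s))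
        atBot (𝓝 1)) ∧
    (3 < s → ∀ α γ : ℝ, α = 2 → γ = Real.sqrt (riemannZeta ((s : ℂ) - 2)).re →
      PathLaplacian.HasStableAsymptotics u α γ) := by
  refine ⟨?_, ?_⟩
  · rintro hs3 _ _ rfl rfl
    have htail := PathLaplacian.tendsto_stableDensity_div_rpow hs hs3
    rw [IsOrderBornology.cobounded_eq, tendsto_sup] at htail
    exact ⟨PathLaplacian.hasStableAsymptotics_of_lt_three hs hs3 hu, htail.2, htail.1⟩
  · rintro hs3 _ _ rfl rfl
    exact PathLaplacian.hasStableAsymptotics_of_three_lt hs3 hu
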